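/- Let $k$ be an algebraically closed field of characteristic zero, $n\ge 0$, and $K=k(t,x_1,\dots,x_n)$ with the derivation $\partial_t=\partial/\partial t$, which restricts to $d/dt$ on $k(t)$. For $F\in\{k(t),K\}$ let $F\langle\partial_t\rangle$ be the ring of linear differential operators $\sum_i a_i\partial_t^i$ with $a_i\in F$ and $\partial_t a=a\partial_t+\partial_t(a)$ for $a\in F$; thus $k(t)\langle\partial_t\rangle\subset K\langle\partial_t\rangle$. An operator $Q$ is a right-hand factor of $P$ if $P=AQ$ for some $A\in F\langle\partial_t\rangle$. The lclm of a family of operators is the monic operator of minimal order of which every member of the family is a right-hand factor, and the maximal completely reducible right-hand factor of $P\neq 0$ is the lclm of all irreducible right-hand factors of $P$ in $F\langle\partial_t\rangle$. A maximal completely reducible (m.c.r.) decomposition of $P\ne 0$ in $F\langle\partial_t\rangle$ is an expression $$P=\lambda H_rH_{r-1}\cdots H_1,\qquad \lambda\in F,\ r\ge 0,$$ with every $H_i\in F\langle\partial_t\rangle$ of positive order and $H_i$ the maximal completely reducible right-hand factor of $H_r\cdots H_i$ in $F\langle\partial_t\rangle$ for $1\le i\le r$. **Lemma.** (1) Let $L\in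 k(t)\langle\partial_t\rangle$ be nonzero. Then $L$ has exactly one m.c.r. decomposition in $k(t)\langle\partial_t\rangle$ and exactly one in $K\langle\partial_t\rangle$, and the two coincide: they have the same $\lambda$, the same $r$ and the same factors $H_1,\dots,H_r$. (2) Every operator that is irreducible in $k(t)\langle\partial_t\rangle$ is irreducible in $K\langle\partial_t\rangle$. -/

import Mathlib

open scoped Polynomial nonZeroDivisors

/-- The derivations of a commutative ring `F` into itself. -/
abbrev Der (F : Type*) [CommRing F] : Type _ := Derivation ℤ F F

/-! ### The ring of linear differential operators over a commutative ring with a derivation -/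

/-- The ring `F⟨∂⟩` of linear differential operators with coefficients in the ring `F` with
derivation `d`.  The operator `∑ aᵢ ∂ⁱ` is stored as the polynomial `∑ aᵢ Xⁱ`; the product
(defined below) is the Ore product, determined by `∂ * a = a * ∂ + d a`. -/
@[ext]
structure DiffOp {F : Type*} [CommRing F] (d : Der F) where
  /-- the polynomial with the same coefficients -/
  toPoly : F[X]

namespace DiffOp

section Ring

variable {F : Type*} [CommRing F] {d : Der F}

/-- Apply a derivation to every coefficient of a polynomial. -/
noncomputable def coeffDeriv (d : Der F) : F[X] →+ F[X] where
  toFun q := q.sum fun j b => Polynomial.monomial j (d b)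
  map_zero' := by simp
  map_add' p q := by
    apply Polynomial.sum_add_index <;> simp

/-- Left multiplication by `∂` on coefficient polynomials:
`∂ (∑ bⱼ ∂ʲ) = ∑ (d bⱼ) ∂ʲ + ∑ bⱼ ∂ʲ⁺¹`. -/
noncomputable def dstep (d : Der F) : F[X] →+ F[X] where
  toFun q := coeffDeriv d q + Polynomial.X * q
  map_zero' := by simp
  map_add' p q := by rw [map_add, mul_add]; abel

/-- The action `(∑ aᵢ ∂ⁱ) q = ∑ aᵢ ∂ⁱ(q)` on coefficient polynomials, with `∂` acting
by `dstep`. -/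
noncomputable def act (d : Der F) (p q : F[X]) : F[X] :=
  p.sum fun i a => Polynomial.C a * (dstep d)^[i] q

theorem coeff_coeffDeriv (q : F[X]) (n : ℕ) : (coeffDeriv d q).coeff n = d (q.coeff n) := by
  change (q.sum fun j b => Polynomial.monomial j (d b)).coeff n = _
  rw [Polynomial.sum_def, Polynomial.finsetSum_coeff]
  simp only [Polynomial.coeff_monomial]
  by_cases h : n ∈ q.support
  · rw [Finset.sum_ite_eq' q.support n fun j => d (q.coeff j), if_pos h]
  · rw [Finset.sum_ite_eq' q.support n fun j => d (q.coeff j), if_neg h,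
      Polynomial.notMem_support_iff.mp h, map_zero]

theorem dstep_apply (q : F[X]) : dstep d q = coeffDeriv d q + Polynomial.X * q := rfl

theorem dstep_C_mul (a : F) (q : F[X]) :
    dstep d (Polynomial.C a * q) = Polynomial.C a * dstep d q + Polynomial.C (d a) * q := by
  have h : coeffDeriv d (Polynomial.C a * q)
      = Polynomial.C a * coeffDeriv d q + Polynomial.C (d a) * q := by
    ext n
    simp only [coeff_coeffDeriv, Polynomial.coeff_add, Polynomial.coeff_C_mul, Derivation.leibniz,
      smul_eq_mul]
    ring
  rw [dstep_apply, dstep_apply, h]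
  ring

theorem act_add_left (p p' q : F[X]) : act d (p + p') q = act d p q + act d p' q := by
  unfold act
  apply Polynomial.sum_add_index <;> simp [add_mul]

theorem act_zero_left (q : F[X]) : act d 0 q = 0 := by simp [act]

theorem act_monomial (i : ℕ) (a : F) (q : F[X]) :
    act d (Polynomial.monomial i a) q = Polynomial.C a * (dstep d)^[i] q := by
  unfold act
  apply Polynomial.sum_monomial_index
  simp

theorem act_add_right (p q q' : F[X]) : act d p (q + q') = act d p q + act d p q' := by
  unfold act
  rw [← Polynomial.sum_add]
  simp only [iterate_map_add, mul_add]

theorem act_zero_right (p : F[X]) : act d p 0 = 0 := by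
  simp [act, iterate_map_zero, Polynomial.sum_def]

theorem act_C_mul (a : F) (p q : F[X]) :
    act d (Polynomial.C a * p) q = Polynomial.C a * act d p q := by
  induction p using Polynomial.induction_on' with
  | add p p' hp hp' => rw [mul_add, act_add_left, hp, hp', act_add_left, mul_add]
  | monomial i b =>
    rw [Polynomial.C_mul_monomial, act_monomial, act_monomial, Polynomial.C_mul, mul_assoc]

theorem act_dstep (p q : F[X]) : act d (dstep d p) q = dstep d (act d p q) := by
  induction p using Polynomial.induction_on' with
  | add p p' hp hp' => rw [map_add, act_add_left, hp, hp', act_add_left, map_add]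
  | monomial i b =>
    have h : dstep d (Polynomial.monomial i b)
        = Polynomial.monomial i (d b) + Polynomial.monomial (i + 1) b := by
      have h1 : coeffDeriv d (Polynomial.monomial i b) = Polynomial.monomial i (d b) := by
        ext n
        rw [coeff_coeffDeriv, Polynomial.coeff_monomial, Polynomial.coeff_monomial]
        split_ifs <;> simp
      rw [dstep_apply, h1, Polynomial.X_mul_monomial]
    rw [h, act_add_left, act_monomial, act_monomial, act_monomial, dstep_C_mul,
      Function.iterate_succ_apply', add_comm]

theorem act_iterate_dstep (i : ℕ) (p q : F[X]) :
    act d ((dstep d)^[i] p) q = (dstep d)^[i] (act d p q) := by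
  induction i with
  | zero => rfl
  | succ i ih => rw [Function.iterate_succ_apply', act_dstep, ih, Function.iterate_succ_apply']

theorem act_act (p q r : F[X]) : act d (act d p q) r = act d p (act d q r) := by
  induction p using Polynomial.induction_on' with
  | add p p' hp hp' => rw [act_add_left, act_add_left, hp, hp', act_add_left]
  | monomial i b => rw [act_monomial, act_C_mul, act_iterate_dstep, act_monomial]

theorem act_one_left (q : F[X]) : act d 1 q = q := by
  rw [← Polynomial.monomial_zero_one, act_monomial]
  simp

theorem act_one_right (p : F[X]) : act d p 1 = p := by
  have h0 : ∀ i : ℕ, (dstep d)^[i] (1 : F[X]) = Polynomial.X ^ i := by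
    intro i
    induction i with
    | zero => simp
    | succ i ih =>
      rw [Function.iterate_succ_apply', ih, dstep_apply]
      have : coeffDeriv d (Polynomial.X ^ i) = 0 := by
        ext n
        rw [coeff_coeffDeriv, Polynomial.coeff_X_pow]
        split_ifs <;> simp
      rw [this, zero_add, pow_succ']
  unfold act
  simp only [h0]
  exact p.sum_C_mul_X_pow_eq

noncomputable instance : Zero (DiffOp d) := ⟨⟨0⟩⟩
noncomputable instance : One (DiffOp d) := ⟨⟨1⟩⟩
noncomputable instance : Add (DiffOp d) := ⟨fun P Q => ⟨P.toPoly + Q.toPoly⟩⟩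
noncomputable instance : Neg (DiffOp d) := ⟨fun P => ⟨-P.toPoly⟩⟩
noncomputable instance : Mul (DiffOp d) := ⟨fun P Q => ⟨act d P.toPoly Q.toPoly⟩⟩

@[simp] theorem toPoly_zero : (0 : DiffOp d).toPoly = 0 := rfl
@[simp] theorem toPoly_one : (1 : DiffOp d).toPoly = 1 := rfl
@[simp] theorem toPoly_add (P Q : DiffOp d) : (P + Q).toPoly = P.toPoly + Q.toPoly := rfl
@[simp] theorem toPoly_neg (P : DiffOp d) : (-P).toPoly = -P.toPoly := rfl
theorem toPoly_mul (P Q : DiffOp d) : (P * Q).toPoly = act d P.toPoly Q.toPoly := rfl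

noncomputable instance : Ring (DiffOp d) where
  add_assoc P Q R := DiffOp.ext (add_assoc _ _ _)
  zero_add P := DiffOp.ext (zero_add _)
  add_zero P := DiffOp.ext (add_zero _)
  add_comm P Q := DiffOp.ext (add_comm _ _)
  neg_add_cancel P := DiffOp.ext (neg_add_cancel _)
  left_distrib P Q R := DiffOp.ext (act_add_right _ _ _)
  right_distrib P Q R := DiffOp.ext (act_add_left _ _ _)
  zero_mul P := DiffOp.ext (act_zero_left (d := d) P.toPoly)
  mul_zero P := DiffOp.ext (act_zero_right (d := d) P.toPoly)
  mul_assoc P Q R := DiffOp.ext (act_act _ _ _)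
  one_mul P := DiffOp.ext (act_one_left _)
  mul_one P := DiffOp.ext (act_one_right _)
  nsmul := nsmulRec
  zsmul := zsmulRec

/-- The operator of order zero given by a coefficient. -/
noncomputable def const (d : Der F) (a : F) : DiffOp d := ⟨Polynomial.C a⟩

/-- The operator `∂`. -/
noncomputable def partialOp (d : Der F) : DiffOp d := ⟨Polynomial.X⟩

theorem const_mul_const (a b : F) : const d a * const d b = const d (a * b) := by
  apply DiffOp.ext
  rw [toPoly_mul]
  simp only [const]
  rw [← Polynomial.monomial_zero_left, act_monomial]
  simp

/-- The commutation rule of `F⟨∂⟩`. -/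
theorem partialOp_mul_const (a : F) :
    partialOp d * const d a = const d a * partialOp d + const d (d a) := by
  have hX (q : F[X]) : act d Polynomial.X q = dstep d q := by
    rw [← Polynomial.monomial_one_one_eq_X, act_monomial]
    simp
  have hC (q : F[X]) : act d (Polynomial.C a) q = Polynomial.C a * q := by
    rw [← Polynomial.monomial_zero_left, act_monomial]
    simp
  have h1 : dstep d (1 : F[X]) = Polynomial.X := by rw [← hX, act_one_right]
  apply DiffOp.ext
  rw [toPoly_add, toPoly_mul, toPoly_mul]
  simp only [const, partialOp]
  rw [hX, hC]
  have := dstep_C_mul (d := d) a 1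
  rwa [mul_one, mul_one, h1] at this

/-- The order of an operator (with `ord 0 = 0`). -/
noncomputable def ord (P : DiffOp d) : ℕ := P.toPoly.natDegree

/-- An operator is monic if its leading coefficient is `1`. -/
def IsMonic (P : DiffOp d) : Prop := P.toPoly.Monic

/-- `Q` is a right-hand factor of `P`, i.e. `P = A * Q` for some operator `A`. -/
def IsRightFactor (Q P : DiffOp d) : Prop := ∃ A : DiffOp d, P = A * Q

/-- `Q` is the least common left multiple of the family `S`: the monic operator of minimal order
that is divisible on the right by every member of `S`. -/
structure IsLCLM (S : Set (DiffOp d)) (Q : DiffOp d) : Prop where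
  monic : Q.IsMonic
  isRightFactor : ∀ P ∈ S, IsRightFactor P Q
  ord_le : ∀ M : DiffOp d, M ≠ 0 → (∀ P ∈ S, IsRightFactor P M) → Q.ord ≤ M.ord

/-- `Q` is the maximal completely reducible right-hand factor of `P`: the least common left
multiple of all irreducible right-hand factors of `P`. -/
def IsMaxCRRightFactor (Q P : DiffOp d) : Prop :=
  IsLCLM {M : DiffOp d | Irreducible M ∧ IsRightFactor M P} Q

/-- `P = lam * H_r * ⋯ * H_1` is a maximal completely reducible decomposition of `P`, where the
list `Hs` is `[H_1, …, H_r]`: for each `i`, the factor `H_i` has positive order and is the maximal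
completely reducible right-hand factor of `H_r * ⋯ * H_i`. -/
structure IsMCRDecomposition (P : DiffOp d) (lam : F) (Hs : List (DiffOp d)) : Prop where
  eq_prod : P = const d lam * Hs.reverse.prod
  ord_pos : ∀ H ∈ Hs, 0 < H.ord
  isMaxCR : ∀ (i : ℕ) (hi : i < Hs.length), IsMaxCRRightFactor Hs[i] (Hs.drop i).reverse.prod

end Ring

section Map

variable {F E : Type*} [CommRing F] [CommRing E] {d : Der F} {e : Der E}

theorem map_dstep (φ : F →+* E) (h : ∀ a, φ (d a) = e (φ a)) (q : F[X]) :
    (dstep d q).map φ = dstep e (q.map φ) := by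
  rw [dstep_apply, dstep_apply, Polynomial.map_add, Polynomial.map_mul, Polynomial.map_X]
  congr 1
  ext n
  simp [coeff_coeffDeriv, h]

theorem map_act (φ : F →+* E) (h : ∀ a, φ (d a) = e (φ a)) (p q : F[X]) :
    (act d p q).map φ = act e (p.map φ) (q.map φ) := by
  have hi : ∀ i : ℕ, ((dstep d)^[i] q).map φ = (dstep e)^[i] (q.map φ) := by
    intro i
    induction i with
    | zero => rfl
    | succ i ih =>
      rw [Function.iterate_succ_apply', map_dstep φ h, ih, Function.iterate_succ_apply']
  induction p using Polynomial.induction_on' with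
  | add p p' hp hp' => rw [act_add_left, Polynomial.map_add, hp, hp', Polynomial.map_add,
      act_add_left]
  | monomial i b => rw [act_monomial, Polynomial.map_mul, Polynomial.map_C, hi,
      Polynomial.map_monomial, act_monomial]

/-- The ring homomorphism `F⟨∂⟩ → E⟨∂⟩` that applies to every coefficient a ring homomorphism
compatible with the derivations. -/
noncomputable def map (φ : F →+* E) (h : ∀ a, φ (d a) = e (φ a)) : DiffOp d →+* DiffOp e where
  toFun P := ⟨P.toPoly.map φ⟩
  map_zero' := by
    apply DiffOp.ext
    exact Polynomial.map_zero φ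
  map_one' := by
    apply DiffOp.ext
    exact Polynomial.map_one φ
  map_add' P Q := by
    apply DiffOp.ext
    exact Polynomial.map_add φ
  map_mul' P Q := by
    apply DiffOp.ext
    exact map_act φ h P.toPoly Q.toPoly

end Map

end DiffOp

/-! ### Extension of a derivation to the fraction field -/

section FracDeriv

variable {A : Type*} (F : Type*) [CommRing A] [IsDomain A] [Field F] [Algebra A F]
  [IsFractionRing A F]

/-- The quotient rule, applied to a chosen representation of `f` as a fraction. -/
noncomputable def fracDerivFun (d : Der A) (f : F) : F :=
  (algebraMap A F (d (IsLocalization.sec A⁰ f).1) * algebraMap A F (IsLocalization.sec A⁰ f).2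
    - algebraMap A F (IsLocalization.sec A⁰ f).1 * algebraMap A F (d (IsLocalization.sec A⁰ f).2))
    / algebraMap A F (IsLocalization.sec A⁰ f).2 ^ 2

variable {F}

/-- The quotient rule holds for every representation as a fraction. -/
theorem fracDerivFun_div (d : Der A) (a b : A) (hb : b ≠ 0) :
    fracDerivFun F d (algebraMap A F a / algebraMap A F b)
      = (algebraMap A F (d a) * algebraMap A F b - algebraMap A F a * algebraMap A F (d b))
        / algebraMap A F b ^ 2 := by
  unfold fracDerivFun
  set f := algebraMap A F a / algebraMap A F b with hf
  have hspec := IsLocalization.sec_spec A⁰ f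
  set n := (IsLocalization.sec A⁰ f).1
  set m := ((IsLocalization.sec A⁰ f).2 : A) with hm
  have hm0 : m ≠ 0 := nonZeroDivisors.ne_zero (IsLocalization.sec A⁰ f).2.2
  have hinj : Function.Injective (algebraMap A F) := IsFractionRing.injective A F
  have hb' : algebraMap A F b ≠ 0 := fun h => hb (hinj (by rw [h, map_zero]))
  have hm' : algebraMap A F m ≠ 0 := fun h => hm0 (hinj (by rw [h, map_zero]))
  have e0 : a * m = n * b := by
    apply hinj
    rw [map_mul, map_mul, ← hspec, hf]
    field_simp
  have e1 : a * d m + m * d a = n * d b + b * d n := by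
    have := congrArg d e0
    simpa [Derivation.leibniz] using this
  have E0 := congrArg (algebraMap A F) e0
  have E1 := congrArg (algebraMap A F) e1
  simp only [map_mul, map_add] at E0 E1
  rw [div_eq_div_iff (pow_ne_zero 2 hm') (pow_ne_zero 2 hb')]
  generalize algebraMap A F a = x at *
  generalize algebraMap A F b = y at *
  generalize algebraMap A F m = z at *
  generalize algebraMap A F n = w at *
  generalize algebraMap A F (d a) = x' at *
  generalize algebraMap A F (d b) = y' at *
  generalize algebraMap A F (d m) = z' at *
  generalize algebraMap A F (d n) = w' at *
  linear_combination (-(y * z)) * E1 + (z * y' + y * z') * E0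

theorem exists_frac (f : F) : ∃ a b : A, b ≠ 0 ∧ f = algebraMap A F a / algebraMap A F b := by
  obtain ⟨a, b, hb, h⟩ := IsFractionRing.div_surjective (A := A) f
  exact ⟨a, b, nonZeroDivisors.ne_zero hb, h.symm⟩

variable (F)

/-- The extension of a derivation of an integral domain to its fraction field. -/
noncomputable def fracDeriv (d : Der A) : Der F :=
  have hinj : Function.Injective (algebraMap A F) := IsFractionRing.injective A F
  have hne : ∀ {b : A}, b ≠ 0 → algebraMap A F b ≠ 0 := fun hb h =>
    hb (hinj (by rw [h, map_zero]))
  have hadd : ∀ f g : F, fracDerivFun F d (f + g) = fracDerivFun F d f + fracDerivFun F d g := by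
    intro f g
    obtain ⟨a, b, hb, rfl⟩ := exists_frac (A := A) f
    obtain ⟨a', b', hb', rfl⟩ := exists_frac (A := A) g
    have hs : algebraMap A F a / algebraMap A F b + algebraMap A F a' / algebraMap A F b'
        = algebraMap A F (a * b' + b * a') / algebraMap A F (b * b') := by
      rw [div_add_div _ _ (hne hb) (hne hb')]
      simp
    rw [hs, fracDerivFun_div d _ _ (mul_ne_zero hb hb'), fracDerivFun_div d _ _ hb,
      fracDerivFun_div d _ _ hb']
    have h1 := hne hb
    have h2 := hne hb'
    simp only [map_mul, map_add, Derivation.leibniz, smul_eq_mul]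
    field_simp
    ring
  have hmul : ∀ f g : F,
      fracDerivFun F d (f * g) = f • fracDerivFun F d g + g • fracDerivFun F d f := by
    intro f g
    obtain ⟨a, b, hb, rfl⟩ := exists_frac (A := A) f
    obtain ⟨a', b', hb', rfl⟩ := exists_frac (A := A) g
    have hs : algebraMap A F a / algebraMap A F b * (algebraMap A F a' / algebraMap A F b')
        = algebraMap A F (a * a') / algebraMap A F (b * b') := by
      rw [div_mul_div_comm]
      simp
    rw [hs, fracDerivFun_div d _ _ (mul_ne_zero hb hb'), fracDerivFun_div d _ _ hb,
      fracDerivFun_div d _ _ hb']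
    have h1 := hne hb
    have h2 := hne hb'
    simp only [map_mul, map_add, Derivation.leibniz, smul_eq_mul]
    field_simp
    ring
  Derivation.mk' (AddMonoidHom.mk' (fracDerivFun F d) hadd).toIntLinearMap hmul

theorem fracDeriv_div (d : Der A) (a b : A) (hb : b ≠ 0) :
    fracDeriv F d (algebraMap A F a / algebraMap A F b)
      = (algebraMap A F (d a) * algebraMap A F b - algebraMap A F a * algebraMap A F (d b))
        / algebraMap A F b ^ 2 :=
  fracDerivFun_div d a b hb

end FracDeriv

/-! ### The differential fields `k(t)` and `k(t, x_1, …, x_n)` -/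

section Fields

variable (k : Type*) [Field k] (n : ℕ)

/-- The polynomial ring `k[t, x_1, …, x_n]`; the variable `none` is `t` and `some i` is `x_i`. -/
abbrev PolyTX : Type _ := MvPolynomial (Option (Fin n)) k

/-- The field `K = k(t, x_1, …, x_n)`. -/
abbrev FieldTX : Type _ := FractionRing (PolyTX k n)

/-- The derivation `d/dt` of `k[t]`. -/
noncomputable def polyDerivT : Der k[X] := Polynomial.derivative'.restrictScalars ℤ

/-- The derivation `∂/∂t` of `k[t, x_1, …, x_n]`. -/
noncomputable def polyDerivTX : Der (PolyTX k n) := (MvPolynomial.pderiv none).restrictScalars ℤ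

/-- The derivation `d/dt` of `k(t)`. -/
noncomputable def derivT : Der (RatFunc k) :=
  fracDeriv (RatFunc k) (polyDerivT k)

/-- The derivation `∂_t = ∂/∂t` of `K = k(t, x_1, …, x_n)`. -/
noncomputable def derivTX : Der (FieldTX k n) :=
  fracDeriv (FieldTX k n) (polyDerivTX k n)

/-- The inclusion `k[t] → k[t, x_1, …, x_n]`. -/
noncomputable def polyIncl : k[X] →ₐ[k] PolyTX k n := Polynomial.aeval (MvPolynomial.X none)

theorem polyIncl_injective : Function.Injective (polyIncl k n) :=
  transcendental_iff_injective.mp (MvPolynomial.transcendental_X k none)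

/-- The inclusion `k(t) → K = k(t, x_1, …, x_n)`. -/
noncomputable def fieldIncl : RatFunc k →+* FieldTX k n :=
  IsFractionRing.lift (A := k[X])
    (g := (algebraMap (PolyTX k n) (FieldTX k n)).comp (polyIncl k n).toRingHom)
    ((IsFractionRing.injective (PolyTX k n) (FieldTX k n)).comp (polyIncl_injective k n))

theorem fieldIncl_algebraMap (p : k[X]) :
    fieldIncl k n (algebraMap k[X] (RatFunc k) p)
      = algebraMap (PolyTX k n) (FieldTX k n) (polyIncl k n p) :=
  IsFractionRing.lift_algebraMap _ p

theorem polyIncl_derivative (p : k[X]) :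
    polyIncl k n (Polynomial.derivative p) = MvPolynomial.pderiv none (polyIncl k n p) := by
  unfold polyIncl
  rw [Derivation.map_aeval]
  simp

theorem fieldIncl_derivT (f : RatFunc k) :
    fieldIncl k n (derivT k f) = derivTX k n (fieldIncl k n f) := by
  obtain ⟨a, b, hb, rfl⟩ := exists_frac (A := k[X]) f
  have hb' : polyIncl k n b ≠ 0 := fun h =>
    hb (polyIncl_injective k n (by rw [h, map_zero]))
  unfold derivT derivTX
  rw [fracDeriv_div _ _ _ _ hb]
  simp only [map_div₀, map_sub, map_mul, map_pow, fieldIncl_algebraMap]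
  rw [fracDeriv_div _ _ _ _ hb']
  have h (p : k[X]) : polyIncl k n (polyDerivT k p) = polyDerivTX k n (polyIncl k n p) :=
    polyIncl_derivative k n p
  rw [h, h]

/-- The inclusion `k(t)⟨∂_t⟩ → K⟨∂_t⟩`. -/
noncomputable def opIncl : DiffOp (derivT k) →+* DiffOp (derivTX k n) :=
  DiffOp.map (fieldIncl k n) (fieldIncl_derivT k n)

end Fields

/-! The proof turns factorization into statements about left ideals. Over a differential field every
left ideal of operators is principal, and a nonzero operator is irreducible exactly when it
generates a maximal left ideal. Hence the maximal completely reducible right-hand factor of `P` is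
the monic generator of the Jacobson radical of the left ideal of `P`, the intersection of the
maximal left ideals above it (`isMaxCRRightFactor_iff`). It exists and is unique, and peeling it off
repeatedly gives existence and uniqueness of the decomposition by induction. What remains is that
this factor is the same over `k(t)` and over `K` (`isMaxCRRightFactor_opIncl`).

Two tools link the fields, both resting on `k` being infinite. Specialization: finitely many
operators over `K` have coefficients defined at a common point `x = c`, and substituting it fixes
operators over `k(t)`. So irreducibility ascends (`irreducible_opIncl`) and divisibility descends.
Translation: the factor `G` of `P` over `K` is invariant under all `x ↦ x + c`, so its coefficients
lie in `k(t)`.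

Let `H` be the factor over `k(t)`. Irreducible right factors of `P` stay irreducible over `K`, hence
divide `G`, so `H` divides `G`. Conversely, complete reducibility of `G` descends to `k(t)`
(`jacobson_span_eq_of_opIncl`): over `K` every left ideal has a complement relative to `G`, this is
witnessed by finitely many operator identities, and these specialize. As `G` divides `P`, it then
divides `H`. -/

namespace DiffOp

/-! ### Top-order behaviour of the Ore product -/

section Ring

variable {F : Type*} [CommRing F] {d : Der F}

/-- Each `dstep` is multiplication by `X` plus a term that does not raise the degree, so from degree
`i + q.natDegree` on only the shift is visible. -/
theorem coeff_iterate_dstep (q : F[X]) (i N : ℕ) (h : i + q.natDegree ≤ N) :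
    ((dstep d)^[i] q).coeff N = q.coeff (N - i) := by
  induction i generalizing N with
  | zero => simp
  | succ i ih =>
    obtain ⟨M, rfl⟩ : ∃ M, N = M + 1 := ⟨N - 1, by omega⟩
    rw [Function.iterate_succ_apply', dstep_apply, Polynomial.coeff_add, coeff_coeffDeriv,
      Polynomial.coeff_X_mul, ih _ (by omega), ih _ (by omega),
      Polynomial.coeff_eq_zero_of_natDegree_lt (n := M + 1 - i) (by omega), map_zero, zero_add]
    congr 1
    omega

/-- The Ore product and the commutative product agree in top degree. -/
theorem coeff_act (p q : F[X]) (N : ℕ) (h : p.natDegree + q.natDegree ≤ N) :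
    (act d p q).coeff N = (p * q).coeff N := by
  have hp : p * q = p.sum fun i a => Polynomial.C a * (Polynomial.X ^ i * q) := by
    conv_lhs => rw [p.as_sum_support]
    simp only [Polynomial.sum_def, ← mul_assoc, Polynomial.C_mul_X_pow_eq_monomial,
      Finset.sum_mul]
  rw [hp, act, Polynomial.sum_def, Polynomial.sum_def, Polynomial.finsetSum_coeff,
    Polynomial.finsetSum_coeff]
  refine Finset.sum_congr rfl fun i hi => ?_
  have hi' := Polynomial.le_natDegree_of_mem_supp i hi
  rw [Polynomial.coeff_C_mul, Polynomial.coeff_C_mul, coeff_iterate_dstep _ _ _ (by omega),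
    Polynomial.coeff_X_pow_mul', if_pos (by omega)]

theorem toPoly_eq_zero {P : DiffOp d} : P.toPoly = 0 ↔ P = 0 :=
  ⟨fun h => DiffOp.ext h, fun h => h ▸ rfl⟩

@[simp] theorem toPoly_sub (P Q : DiffOp d) : (P - Q).toPoly = P.toPoly - Q.toPoly := by
  rw [sub_eq_add_neg, sub_eq_add_neg, toPoly_add, toPoly_neg]

theorem const_one : const d (1 : F) = 1 := DiffOp.ext Polynomial.C_1

theorem toPoly_const_mul (a : F) (P : DiffOp d) :
    (const d a * P).toPoly = Polynomial.C a * P.toPoly := by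
  rw [toPoly_mul]
  simp only [const]
  rw [← Polynomial.monomial_zero_left, act_monomial]
  simp

theorem IsMonic.one : (1 : DiffOp d).IsMonic := Polynomial.monic_one

end Ring

/-! ### Change of coefficient ring -/

section Map

variable {F E : Type*} [CommRing F] [CommRing E] {d : Der F} {e : Der E}

theorem map_injective (φ : F →+* E) (h : ∀ a, φ (d a) = e (φ a))
    (hφ : Function.Injective φ) : Function.Injective (map φ h) := fun _ _ hPQ =>
  DiffOp.ext (Polynomial.map_injective φ hφ (congrArg toPoly hPQ))

theorem mem_range_map (φ : F →+* E) (h : ∀ a, φ (d a) = e (φ a)) (P : DiffOp e)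
    (hP : ∀ i, P.toPoly.coeff i ∈ φ.range) : ∃ Q, map φ h Q = P := by
  have h1 : P.toPoly ∈ Polynomial.lifts φ :=
    (Polynomial.lifts_iff_coeff_lifts _).2 fun i => by simpa using hP i
  obtain ⟨q, hq⟩ := (Polynomial.mem_lifts _).1 h1
  exact ⟨⟨q⟩, DiffOp.ext hq⟩

theorem ord_map (φ : F →+* E) (h : ∀ a, φ (d a) = e (φ a)) (hφ : Function.Injective φ)
    (P : DiffOp d) : (map φ h P).ord = P.ord :=
  Polynomial.natDegree_map_eq_of_injective hφ _

theorem IsMonic.map {P : DiffOp d} (hP : P.IsMonic) (φ : F →+* E)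
    (h : ∀ a, φ (d a) = e (φ a)) : (map φ h P).IsMonic :=
  Polynomial.Monic.map φ hP

theorem isMonic_map_iff (φ : F →+* E) (h : ∀ a, φ (d a) = e (φ a)) (hφ : Function.Injective φ)
    {P : DiffOp d} : (DiffOp.map φ h P).IsMonic ↔ P.IsMonic :=
  ⟨fun hP => Polynomial.monic_of_injective hφ hP, fun hP => hP.map φ h⟩

theorem map_const (φ : F →+* E) (h : ∀ a, φ (d a) = e (φ a)) (a : F) :
    map φ h (const d a) = const e (φ a) :=
  DiffOp.ext (Polynomial.map_C φ)

end Map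

/-! ### Operators over a differential field: order, division, left ideals -/

section Field

variable {F : Type*} [Field F] {d : Der F}

theorem coeff_mul_ord_add_ord (P Q : DiffOp d) :
    (P * Q).toPoly.coeff (P.ord + Q.ord) = P.toPoly.leadingCoeff * Q.toPoly.leadingCoeff := by
  rw [toPoly_mul, coeff_act _ _ (P.ord + Q.ord) le_rfl]
  exact Polynomial.coeff_mul_degree_add_degree _ _

instance : Nontrivial (DiffOp d) :=
  ⟨⟨0, 1, fun h => zero_ne_one (congrArg toPoly h)⟩⟩

instance : NoZeroDivisors (DiffOp d) where
  eq_zero_or_eq_zero_of_mul_eq_zero {P Q} h := by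
    have := coeff_mul_ord_add_ord P Q
    rw [h, toPoly_zero, Polynomial.coeff_zero, eq_comm, mul_eq_zero,
      Polynomial.leadingCoeff_eq_zero, Polynomial.leadingCoeff_eq_zero] at this
    exact this.imp toPoly_eq_zero.1 toPoly_eq_zero.1

instance : IsDomain (DiffOp d) := NoZeroDivisors.to_isDomain _

theorem ord_mul {P Q : DiffOp d} (hP : P ≠ 0) (hQ : Q ≠ 0) : (P * Q).ord = P.ord + Q.ord := by
  apply Polynomial.natDegree_eq_of_le_of_coeff_ne_zero
  · rw [Polynomial.natDegree_le_iff_coeff_eq_zero]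
    intro N hN
    rw [toPoly_mul, coeff_act _ _ _ hN.le]
    exact Polynomial.coeff_eq_zero_of_natDegree_lt (Polynomial.natDegree_mul_le.trans_lt hN)
  · rw [coeff_mul_ord_add_ord]
    exact mul_ne_zero (Polynomial.leadingCoeff_ne_zero.2 (mt toPoly_eq_zero.1 hP))
      (Polynomial.leadingCoeff_ne_zero.2 (mt toPoly_eq_zero.1 hQ))

theorem leadingCoeff_mul (P Q : DiffOp d) :
    (P * Q).toPoly.leadingCoeff = P.toPoly.leadingCoeff * Q.toPoly.leadingCoeff := by
  by_cases hP : P = 0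
  · simp [hP]
  by_cases hQ : Q = 0
  · simp [hQ]
  rw [← coeff_mul_ord_add_ord, ← ord_mul hP hQ]
  rfl

theorem IsMonic.ne_zero {P : DiffOp d} (hP : P.IsMonic) : P ≠ 0 := fun h =>
  Polynomial.Monic.ne_zero hP (toPoly_eq_zero.2 h)

theorem IsMonic.mul {P Q : DiffOp d} (hP : P.IsMonic) (hQ : Q.IsMonic) : (P * Q).IsMonic := by
  unfold IsMonic at *
  rw [Polynomial.Monic, leadingCoeff_mul, hP.leadingCoeff, hQ.leadingCoeff, mul_one]

theorem IsMonic.of_mul {P Q : DiffOp d} (h : (P * Q).IsMonic) (hQ : Q.IsMonic) : P.IsMonic := by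
  unfold IsMonic at *
  rwa [Polynomial.Monic, leadingCoeff_mul, hQ.leadingCoeff, mul_one] at h

theorem IsMonic.eq_one {P : DiffOp d} (hP : P.IsMonic) (h : P.ord = 0) : P = 1 :=
  DiffOp.ext ((Polynomial.Monic.natDegree_eq_zero hP).1 h)

theorem isUnit_const {a : F} (ha : a ≠ 0) : IsUnit (const d a) :=
  ⟨⟨const d a, const d a⁻¹, by rw [const_mul_const, mul_inv_cancel₀ ha, const_one],
    by rw [const_mul_const, inv_mul_cancel₀ ha, const_one]⟩, rfl⟩

theorem isUnit_iff {P : DiffOp d} : IsUnit P ↔ P ≠ 0 ∧ P.ord = 0 := by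
  constructor
  · rintro ⟨u, rfl⟩
    refine ⟨u.ne_zero, ?_⟩
    have h := ord_mul u.ne_zero u⁻¹.ne_zero
    rw [u.mul_inv] at h
    have h1 : (1 : DiffOp d).ord = 0 := Polynomial.natDegree_one
    omega
  · rintro ⟨h0, h⟩
    have hP : P = const d (P.toPoly.coeff 0) :=
      DiffOp.ext (Polynomial.eq_C_of_natDegree_eq_zero h)
    rw [hP]
    refine isUnit_const fun hc => h0 ?_
    rw [hP, hc]
    exact DiffOp.ext Polynomial.C_0

/-- Every nonzero operator is a unit times a monic one. -/
theorem exists_const_mul_isMonic {P : DiffOp d} (hP : P ≠ 0) :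
    ∃ Q : DiffOp d, Q.IsMonic ∧ P = const d P.toPoly.leadingCoeff * Q := by
  have hl : P.toPoly.leadingCoeff ≠ 0 :=
    Polynomial.leadingCoeff_ne_zero.2 (mt toPoly_eq_zero.1 hP)
  refine ⟨const d P.toPoly.leadingCoeff⁻¹ * P, ?_, ?_⟩
  · unfold IsMonic
    rw [toPoly_const_mul, Polynomial.Monic, Polynomial.leadingCoeff_mul,
      Polynomial.leadingCoeff_C, inv_mul_cancel₀ hl]
  · rw [← mul_assoc, const_mul_const, mul_inv_cancel₀ hl, const_one, one_mul]

theorem leadingCoeff_const_mul {a : F} {Q : DiffOp d} (hQ : Q.IsMonic) :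
    (const d a * Q).toPoly.leadingCoeff = a := by
  rw [toPoly_const_mul, Polynomial.leadingCoeff_mul, Polynomial.leadingCoeff_C,
    Polynomial.Monic.leadingCoeff hQ, mul_one]

/-- One step of right division. -/
theorem exists_degree_sub_mul_lt {A B : DiffOp d} (hA : A ≠ 0) (hB : B ≠ 0) (h : B.ord ≤ A.ord) :
    ∃ Q : DiffOp d, (A - Q * B).toPoly.degree < A.toPoly.degree := by
  have hlA : A.toPoly.leadingCoeff ≠ 0 :=
    Polynomial.leadingCoeff_ne_zero.2 (mt toPoly_eq_zero.1 hA)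
  have hlB : B.toPoly.leadingCoeff ≠ 0 :=
    Polynomial.leadingCoeff_ne_zero.2 (mt toPoly_eq_zero.1 hB)
  set a := A.toPoly.leadingCoeff / B.toPoly.leadingCoeff with ha
  have ha0 : a ≠ 0 := div_ne_zero hlA hlB
  let Q : DiffOp d := ⟨Polynomial.monomial (A.ord - B.ord) a⟩
  have hQ : Q ≠ 0 := fun h0 => ha0 <|
    (Polynomial.monomial_eq_zero_iff a (A.ord - B.ord)).1 (toPoly_eq_zero.2 h0)
  have hQo : Q.ord = A.ord - B.ord := Polynomial.natDegree_monomial_eq _ ha0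
  have hQB : (Q * B).toPoly ≠ 0 := mt toPoly_eq_zero.1 (mul_ne_zero hQ hB)
  have hA' : A.toPoly ≠ 0 := mt toPoly_eq_zero.1 hA
  refine ⟨Q, ?_⟩
  rw [toPoly_sub]
  apply Polynomial.degree_sub_lt_left
  · rw [Polynomial.degree_eq_natDegree hA', Polynomial.degree_eq_natDegree hQB]
    have := ord_mul hQ hB
    rw [hQo, Nat.sub_add_cancel h] at this
    exact congrArg _ this.symm
  · exact hA'
  · rw [leadingCoeff_mul, Polynomial.leadingCoeff_monomial, ha, div_mul_cancel₀ _ hlB]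

/-- Left ideals of `F⟨∂⟩` are principal. -/
instance : IsPrincipalIdealRing (DiffOp d) where
  principal I := by
    by_cases hI : I = ⊥
    · exact hI ▸ bot_isPrincipal
    obtain ⟨G₀, hG₀, hG₀'⟩ := Submodule.exists_mem_ne_zero_of_ne_bot hI
    have hne : ∃ m, ∃ G ∈ I, G ≠ 0 ∧ G.ord = m := ⟨_, G₀, hG₀, hG₀', rfl⟩
    classical
    obtain ⟨G, hGI, hG0, hG⟩ := Nat.find_spec hne
    refine ⟨G, le_antisymm (fun A hA => ?_) ((Submodule.span_singleton_le_iff_mem _ _).2 hGI)⟩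
    -- The induction runs on `degree` and not on `ord`, so that a zero remainder counts as smaller
    -- than a nonzero constant.
    induction hm : A.toPoly.degree using WellFoundedLT.induction generalizing A with
    | ind m ih =>
      by_cases hA0 : A = 0
      · exact hA0 ▸ Submodule.zero_mem _
      have hle : G.ord ≤ A.ord := hG ▸ Nat.find_min' hne ⟨A, hA, hA0, rfl⟩
      obtain ⟨Q, hQ⟩ := exists_degree_sub_mul_lt hA0 hG0 hle
      have h1 := ih _ (hm ▸ hQ) _ (I.sub_mem hA (I.mul_mem_left Q hGI)) rfl
      have h2 : Q * G ∈ Submodule.span (DiffOp d) {G} :=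
        Submodule.smul_mem _ Q (Submodule.mem_span_singleton_self G)
      simpa using add_mem h1 h2

theorem isRightFactor_iff {P Q : DiffOp d} : IsRightFactor Q P ↔ P ∈ Ideal.span {Q} := by
  rw [Ideal.mem_span_singleton']
  exact ⟨fun ⟨A, h⟩ => ⟨A, h.symm⟩, fun ⟨A, h⟩ => ⟨A, h.symm⟩⟩

theorem span_isUnit_mul {u : DiffOp d} (hu : IsUnit u) (P : DiffOp d) :
    Ideal.span {u * P} = Ideal.span {P} :=
  Submodule.span_singleton_smul_eq hu P

theorem exists_isMonic_span_eq {I : Ideal (DiffOp d)} (hI : I ≠ ⊥) :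
    ∃ G : DiffOp d, G.IsMonic ∧ Ideal.span {G} = I := by
  obtain ⟨G, hG⟩ := (IsPrincipalIdealRing.principal I).principal
  change I = Ideal.span {G} at hG
  have hG0 : G ≠ 0 := by
    rintro rfl
    exact hI (by simpa using hG)
  obtain ⟨Q, hQ, h⟩ := exists_const_mul_isMonic hG0
  refine ⟨Q, hQ, ?_⟩
  rw [hG, h, span_isUnit_mul (isUnit_const _)]
  exact Polynomial.leadingCoeff_ne_zero.2 (mt toPoly_eq_zero.1 hG0)

theorem ord_le_of_mem_span {P Q : DiffOp d} (hP : P ≠ 0) (h : P ∈ Ideal.span {Q}) :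
    Q.ord ≤ P.ord := by
  obtain ⟨A, rfl⟩ := Ideal.mem_span_singleton'.1 h
  rw [ord_mul (left_ne_zero_of_mul hP) (right_ne_zero_of_mul hP)]
  omega

/-- By additivity of orders the cofactor has order zero, hence is a unit. -/
theorem span_eq_of_mem_of_ord_le {P Q : DiffOp d} (hP : P ≠ 0) (h : P ∈ Ideal.span {Q})
    (ho : P.ord ≤ Q.ord) : Ideal.span {P} = Ideal.span {Q} := by
  obtain ⟨A, rfl⟩ := Ideal.mem_span_singleton'.1 h
  rw [ord_mul (left_ne_zero_of_mul hP) (right_ne_zero_of_mul hP)] at ho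
  exact span_isUnit_mul (isUnit_iff.2 ⟨left_ne_zero_of_mul hP, by omega⟩) Q

theorem IsMonic.eq_of_span_eq {P Q : DiffOp d} (hP : P.IsMonic) (hQ : Q.IsMonic)
    (h : Ideal.span {P} = Ideal.span {Q}) : P = Q := by
  have h1 : P ∈ Ideal.span {Q} := h ▸ Ideal.mem_span_singleton_self P
  have h2 : Q ∈ Ideal.span {P} := h ▸ Ideal.mem_span_singleton_self Q
  have ho := (ord_le_of_mem_span hP.ne_zero h1).antisymm (ord_le_of_mem_span hQ.ne_zero h2)
  obtain ⟨A, rfl⟩ := Ideal.mem_span_singleton'.1 h1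
  have hA : A.IsMonic := hP.of_mul hQ
  rw [ord_mul hA.ne_zero hQ.ne_zero] at ho
  rw [hA.eq_one (by omega), one_mul]

theorem span_eq_top_iff {P : DiffOp d} : Ideal.span {P} = ⊤ ↔ IsUnit P := by
  rw [Ideal.eq_top_iff_one, Ideal.mem_span_singleton']
  constructor
  · rintro ⟨A, h⟩
    exact IsUnit.of_mul_eq_one_right A h
  · rintro ⟨u, rfl⟩
    exact ⟨_, u.inv_mul⟩

/-- The left ideals above that of `P` are generated by the right factors of `P`. Such an ideal is
everything when the right factor is a unit, and equals that of `P` when the cofactor is a unit. -/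
theorem irreducible_iff_isMaximal {P : DiffOp d} (hP : P ≠ 0) :
    Irreducible P ↔ (Ideal.span {P}).IsMaximal := by
  constructor
  · intro h
    refine ⟨⟨mt span_eq_top_iff.1 h.not_isUnit, fun J hJ => ?_⟩⟩
    obtain ⟨B, hB⟩ := (IsPrincipalIdealRing.principal J).principal
    change J = Ideal.span {B} at hB
    subst hB
    obtain ⟨A, rfl⟩ := Ideal.mem_span_singleton'.1 (hJ.le (Ideal.mem_span_singleton_self P))
    rcases h.isUnit_or_isUnit rfl with hA | hB
    · exact absurd (span_isUnit_mul hA B) hJ.ne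
    · exact span_eq_top_iff.2 hB
  · intro h
    refine ⟨mt span_eq_top_iff.2 h.ne_top, fun A B hAB => ?_⟩
    subst hAB
    by_cases hB : IsUnit B
    · exact Or.inr hB
    refine Or.inl (isUnit_iff.2 ⟨left_ne_zero_of_mul hP, ?_⟩)
    have hle : Ideal.span {A * B} ≤ Ideal.span {B} :=
      (Ideal.span_singleton_le_iff_mem _).2 (Ideal.mem_span_singleton'.2 ⟨A, rfl⟩)
    have heq := h.eq_of_le (mt span_eq_top_iff.1 hB) hle
    have hB' : B ∈ Ideal.span {A * B} := heq ▸ Ideal.mem_span_singleton_self B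
    have := ord_le_of_mem_span (right_ne_zero_of_mul hP) hB'
    rw [ord_mul (left_ne_zero_of_mul hP) (right_ne_zero_of_mul hP)] at this
    omega

/-! ### The maximal completely reducible right-hand factor -/

/-- The maximal left ideals containing `P` are generated by its irreducible right factors; `P ≠ 0`
excludes the zero generator. -/
theorem mem_jacobson_span_iff {P X : DiffOp d} (hP : P ≠ 0) :
    X ∈ (Ideal.span {P}).jacobson ↔
      ∀ M : DiffOp d, Irreducible M ∧ IsRightFactor M P → IsRightFactor M X := by
  simp only [Ideal.jacobson, Submodule.mem_sInf, isRightFactor_iff, Set.mem_ofPred_eq]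
  constructor
  · rintro h M ⟨hM, hMP⟩
    exact h _ ⟨(Ideal.span_singleton_le_iff_mem _).2 hMP,
      (irreducible_iff_isMaximal hM.ne_zero).1 hM⟩
  · rintro h J ⟨hPJ, hJ⟩
    obtain ⟨M, hM⟩ := (IsPrincipalIdealRing.principal J).principal
    change J = Ideal.span {M} at hM
    subst hM
    have hMP := (Ideal.span_singleton_le_iff_mem _).1 hPJ
    refine h M ⟨(irreducible_iff_isMaximal ?_).2 hJ, hMP⟩
    rintro rfl
    exact hP (by simpa using hMP)

/-- The common left multiples of the irreducible right factors form the Jacobson radical, which is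
nonzero because it contains `P`. In a principal left ideal the nonzero elements of least order are
the generators. -/
theorem isMaxCRRightFactor_iff {H P : DiffOp d} (hP : P ≠ 0) :
    IsMaxCRRightFactor H P ↔ H.IsMonic ∧ Ideal.span {H} = (Ideal.span {P}).jacobson := by
  constructor
  · rintro ⟨hm, hr, ho⟩
    refine ⟨hm, ?_⟩
    have hPJ : P ∈ (Ideal.span {P}).jacobson :=
      Ideal.le_jacobson (Ideal.mem_span_singleton_self P)
    have hJ : (Ideal.span {P}).jacobson ≠ ⊥ := fun h => hP (by rwa [h] at hPJ)
    obtain ⟨G, hG, hGJ⟩ := exists_isMonic_span_eq hJ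
    rw [← hGJ]
    refine span_eq_of_mem_of_ord_le hm.ne_zero (hGJ ▸ (mem_jacobson_span_iff hP).2 hr) ?_
    exact ho G hG.ne_zero ((mem_jacobson_span_iff hP).1 (hGJ ▸ Ideal.mem_span_singleton_self G))
  · rintro ⟨hm, hH⟩
    refine ⟨hm, (mem_jacobson_span_iff hP).1 (hH ▸ Ideal.mem_span_singleton_self H), ?_⟩
    intro M hM h
    exact ord_le_of_mem_span hM (hH ▸ (mem_jacobson_span_iff hP).2 h)

theorem exists_isMaxCRRightFactor {P : DiffOp d} (hP : P ≠ 0) :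
    ∃ H : DiffOp d, IsMaxCRRightFactor H P := by
  have hPJ : P ∈ (Ideal.span {P}).jacobson :=
    Ideal.le_jacobson (Ideal.mem_span_singleton_self P)
  obtain ⟨G, hG, hGJ⟩ := exists_isMonic_span_eq (fun h => hP (by rwa [h] at hPJ) :
    (Ideal.span {P}).jacobson ≠ ⊥)
  exact ⟨G, (isMaxCRRightFactor_iff hP).2 ⟨hG, hGJ⟩⟩

theorem IsMaxCRRightFactor.unique {H H' P : DiffOp d} (hP : P ≠ 0)
    (h : IsMaxCRRightFactor H P) (h' : IsMaxCRRightFactor H' P) : H = H' := by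
  rw [isMaxCRRightFactor_iff hP] at h h'
  exact h.1.eq_of_span_eq h'.1 (h.2.trans h'.2.symm)

theorem IsMaxCRRightFactor.isRightFactor {H P : DiffOp d} (hP : P ≠ 0)
    (h : IsMaxCRRightFactor H P) : IsRightFactor H P := by
  rw [isRightFactor_iff, ((isMaxCRRightFactor_iff hP).1 h).2]
  exact Ideal.le_jacobson (Ideal.mem_span_singleton_self P)

/-- A proper left ideal lies in a maximal one, so its radical is proper too. -/
theorem IsMaxCRRightFactor.ord_pos {H P : DiffOp d} (hP : P ≠ 0) (ho : 0 < P.ord)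
    (h : IsMaxCRRightFactor H P) : 0 < H.ord := by
  rw [isMaxCRRightFactor_iff hP] at h
  rw [pos_iff_ne_zero]
  intro h0
  have h1 : Ideal.span {P} = ⊤ := by
    rw [← Ideal.jacobson_eq_top_iff, ← h.2, span_eq_top_iff]
    exact isUnit_iff.2 ⟨h.1.ne_zero, h0⟩
  have := (isUnit_iff.1 (span_eq_top_iff.1 h1)).2
  omega

/-- Ring automorphisms that come from the coefficient field respect maximal completely reducible
right-hand factors. -/
theorem IsMaxCRRightFactor.mapEquiv {H P : DiffOp d} (h : IsMaxCRRightFactor H P)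
    (σ : DiffOp d ≃+* DiffOp d) (hm : ∀ Q, IsMonic Q → IsMonic (σ Q))
    (ho : ∀ Q, (σ Q).ord = Q.ord) : IsMaxCRRightFactor (σ H) (σ P) := by
  have hr : ∀ {A B : DiffOp d}, IsRightFactor A B → IsRightFactor (σ A) (σ B) := by
    rintro A B ⟨C, rfl⟩
    exact ⟨σ C, map_mul σ C A⟩
  have hr' : ∀ {A B : DiffOp d}, IsRightFactor A (σ B) → IsRightFactor (σ.symm A) B := by
    rintro A B ⟨C, hC⟩
    exact ⟨σ.symm C, by rw [← map_mul, ← hC, RingEquiv.symm_apply_apply]⟩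
  refine ⟨hm _ h.monic, ?_, ?_⟩
  · rintro M ⟨hM, hMP⟩
    have := hr (IsLCLM.isRightFactor h (σ.symm M)
      ⟨(MulEquiv.irreducible_iff σ.symm).2 hM, hr' hMP⟩)
    rwa [RingEquiv.apply_symm_apply] at this
  · intro M hM hMS
    have := IsLCLM.ord_le h (σ.symm M) (by simpa using hM) ?_
    · rwa [ho, ← ho (σ.symm M), RingEquiv.apply_symm_apply] at *
    · rintro N ⟨hN, hNP⟩
      have := hr' (B := σ.symm M) (A := σ N)
        (by simpa using hMS (σ N) ⟨(MulEquiv.irreducible_iff σ).2 hN, hr hNP⟩)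
      simpa using this

/-! ### Maximal completely reducible decompositions -/

theorem IsMCRDecomposition.isMonic_of_mem {P : DiffOp d} {a : F} {Hs : List (DiffOp d)}
    (h : P.IsMCRDecomposition a Hs) : ∀ H ∈ Hs, H.IsMonic := by
  intro H hH
  obtain ⟨i, hi, rfl⟩ := List.getElem_of_mem hH
  exact (h.isMaxCR i hi).monic

theorem isMonic_reverse_prod {Hs : List (DiffOp d)} (h : ∀ H ∈ Hs, H.IsMonic) :
    Hs.reverse.prod.IsMonic := by
  induction Hs with
  | nil => simpa using IsMonic.one
  | cons H Hs ih =>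
    simp only [List.reverse_cons, List.prod_append, List.prod_singleton]
    exact (ih fun G hG => h G (List.mem_cons_of_mem _ hG)).mul (h H List.mem_cons_self)

/-- All factors are monic, so the scalar can only be the leading coefficient; the remaining
conditions involve the list alone. This reduces everything to monic operators. -/
theorem isMCRDecomposition_const_mul {P : DiffOp d} (hP : P.IsMonic) {a b : F} (ha : a ≠ 0)
    {Hs : List (DiffOp d)} :
    (const d a * P).IsMCRDecomposition b Hs ↔ b = a ∧ P.IsMCRDecomposition 1 Hs := by
  constructor
  · intro h
    have hb := congrArg (fun Q : DiffOp d => Q.toPoly.leadingCoeff) h.eq_prod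
    simp only [leadingCoeff_const_mul hP,
      leadingCoeff_const_mul (isMonic_reverse_prod h.isMonic_of_mem)] at hb
    subst hb
    refine ⟨rfl, ?_, h.ord_pos, h.isMaxCR⟩
    rw [const_one, one_mul]
    exact mul_left_cancel₀ (isUnit_const ha).ne_zero h.eq_prod
  · rintro ⟨rfl, h⟩
    refine ⟨?_, h.ord_pos, h.isMaxCR⟩
    conv_lhs => rw [h.eq_prod, const_one, one_mul]

theorem isMCRDecomposition_nil {P : DiffOp d} : P.IsMCRDecomposition 1 [] ↔ P = 1 := by
  constructor
  · intro h
    simpa [const_one] using h.eq_prod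
  · rintro rfl
    exact ⟨by simp [const_one], by simp, by simp⟩

/-- The recursive form used in the inductions: index `0` concerns the whole product, and index `i +
1` is the condition at `i` for the tail. -/
theorem isMCRDecomposition_cons {P H : DiffOp d} {Hs : List (DiffOp d)} :
    P.IsMCRDecomposition 1 (H :: Hs) ↔
      0 < H.ord ∧ IsMaxCRRightFactor H P ∧
        ∃ P' : DiffOp d, P = P' * H ∧ P'.IsMCRDecomposition 1 Hs := by
  have hcons : (H :: Hs).reverse.prod = Hs.reverse.prod * H := by simp
  constructor
  · intro h
    have hP := h.eq_prod
    rw [const_one, one_mul] at hP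
    refine ⟨h.ord_pos H List.mem_cons_self, ?_, Hs.reverse.prod, hP.trans hcons, ?_, ?_, ?_⟩
    · have := h.isMaxCR 0 (by simp)
      rwa [List.drop_zero, ← hP, List.getElem_cons_zero] at this
    · rw [const_one, one_mul]
    · exact fun G hG => h.ord_pos G (List.mem_cons_of_mem _ hG)
    · intro i hi
      exact h.isMaxCR (i + 1) (by simpa using hi)
  · rintro ⟨h0, hH, P', rfl, h⟩
    have hP := h.eq_prod
    rw [const_one, one_mul] at hP
    refine ⟨?_, ?_, ?_⟩
    · rw [const_one, one_mul, hcons, ← hP]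
    · intro G hG
      rcases List.mem_cons.1 hG with rfl | hG
      · exact h0
      · exact h.ord_pos G hG
    · rintro (_ | i) hi
      · rwa [List.drop_zero, hcons, ← hP]
      · exact h.isMaxCR i (by simpa using hi)

/-- The heads agree by uniqueness of the maximal completely reducible right-hand factor; they cancel
on the right because the ring is a domain. -/
theorem IsMCRDecomposition.unique {P : DiffOp d} (hP : P.IsMonic) {Hs Gs : List (DiffOp d)}
    (h : P.IsMCRDecomposition 1 Hs) (h' : P.IsMCRDecomposition 1 Gs) : Gs = Hs := by
  -- Lists of different lengths are impossible: `1` has no right factor of positive order.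
  have aux : ∀ {H : DiffOp d} {Hs : List (DiffOp d)},
      ¬ (1 : DiffOp d).IsMCRDecomposition 1 (H :: Hs) := by
    intro H Hs h
    obtain ⟨h0, -, P', hP', -⟩ := isMCRDecomposition_cons.1 h
    have := ord_le_of_mem_span (one_ne_zero (α := DiffOp d))
      (Ideal.mem_span_singleton'.2 ⟨P', hP'.symm⟩)
    have h1 : (1 : DiffOp d).ord = 0 := Polynomial.natDegree_one
    omega
  induction Hs generalizing P Gs with
  | nil =>
    obtain rfl := isMCRDecomposition_nil.1 h
    cases Gs with
    | nil => rfl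
    | cons G Gs => exact absurd h' aux
  | cons H Hs ih =>
    cases Gs with
    | nil =>
      obtain rfl := isMCRDecomposition_nil.1 h'
      exact absurd h aux
    | cons G Gs =>
      obtain ⟨-, hH, A, hA, hA'⟩ := isMCRDecomposition_cons.1 h
      obtain ⟨-, hG, B, hB, hB'⟩ := isMCRDecomposition_cons.1 h'
      obtain rfl := hH.unique hP.ne_zero hG
      obtain rfl : A = B := mul_right_cancel₀ hH.monic.ne_zero (hA.symm.trans hB)
      rw [ih (IsMonic.of_mul (hA ▸ hP) hH.monic) hA' hB']

/-! ### Complements -/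

/-- Above a left ideal that is an intersection of maximal left ideals, every left ideal has a
complement. -/
theorem exists_complement {G : DiffOp d} (hG : G ≠ 0)
    (hJ : (Ideal.span {G}).jacobson = Ideal.span {G}) (I : Ideal (DiffOp d)) :
    ∃ C : DiffOp d, G ∈ Ideal.span {C} ∧ I ⊔ Ideal.span {C} = ⊤ ∧
      I ⊓ Ideal.span {C} ≤ Ideal.span {G} := by
  -- Larger order means a smaller ideal, so a candidate of maximal order is as close to a complement
  -- as possible; orders are bounded by that of `G`.
  let S : Set ℕ := {m | ∃ C : DiffOp d, G ∈ Ideal.span {C} ∧ I ⊔ Ideal.span {C} = ⊤ ∧ C.ord = m}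
  have hne : S.Nonempty := ⟨_, 1, by simp, by simp, rfl⟩
  have hbdd : BddAbove S := ⟨G.ord, by
    rintro _ ⟨C, hC, -, rfl⟩
    exact ord_le_of_mem_span hG hC⟩
  obtain ⟨C, hGC, htop, hC⟩ := Nat.sSup_mem hne hbdd
  refine ⟨C, hGC, htop, ?_⟩
  rw [← hJ]
  refine le_sInf ?_
  rintro m ⟨hGm, hm⟩
  by_contra hnot
  have hGm' := (Ideal.span_singleton_le_iff_mem _).1 hGm
  have hsup : I ⊓ Ideal.span {C} ⊔ m = ⊤ := hm.1.2 _ (right_lt_sup.2 hnot)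
  obtain ⟨A, hA⟩ := (IsPrincipalIdealRing.principal (m ⊓ Ideal.span {C})).principal
  change m ⊓ Ideal.span {C} = Ideal.span {A} at hA
  -- Modular law: if a maximal `m` above `G` misses part of the intersection, then replacing the
  -- ideal of `C` by its intersection with `m` still gives a candidate. Maximality of the order then
  -- forces `C ∈ m`.
  have hmod : Ideal.span {C} = I ⊓ Ideal.span {C} ⊔ Ideal.span {A} := by
    rw [← hA, ← sup_inf_assoc_of_le m inf_le_right, hsup, top_inf_eq]
  have hGA : G ∈ Ideal.span {A} := hA ▸ ⟨hGm', hGC⟩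
  have hA0 : A ≠ 0 := by
    rintro rfl
    exact hG (by simpa using hGA)
  have hAm : A ∈ m ⊓ Ideal.span {C} := hA ▸ Ideal.mem_span_singleton_self A
  have hAtop : I ⊔ Ideal.span {A} = ⊤ := by
    rw [eq_top_iff, ← htop]
    refine sup_le le_sup_left ?_
    rw [hmod]
    exact sup_le_sup_right inf_le_left _
  have hle : A.ord ≤ C.ord := hC ▸ le_csSup hbdd ⟨A, hGA, hAtop, rfl⟩
  have heq := span_eq_of_mem_of_ord_le hA0 hAm.2 hle
  exact hnot (inf_le_right.trans (heq ▸ (Ideal.span_singleton_le_iff_mem _).2 hAm.1))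

end Field

/-- A left ideal whose Jacobson radical has a relative complement is equal to its radical. -/
theorem jacobson_eq_of_complement {R : Type*} [Ring R] {I C : Ideal R} (hIC : I ≤ C)
    (htop : I.jacobson ⊔ C = ⊤) (hinf : I.jacobson ⊓ C ≤ I) : I.jacobson = I := by
  -- A maximal left ideal above `C` contains `I`, hence its radical, hence the sum of the radical
  -- with `C`.
  have hC : C = ⊤ := by
    by_contra hC
    obtain ⟨m, hm, hCm⟩ := Ideal.exists_le_maximal C hC
    have h1 : I.jacobson ≤ m := sInf_le ⟨hIC.trans hCm, hm⟩
    exact hm.ne_top (top_le_iff.1 (htop ▸ sup_le h1 hCm))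
  subst hC
  exact le_antisymm (by simpa using hinf) Ideal.le_jacobson

end DiffOp

/-! ### Specialization of fractions -/

section Specialization

variable {A B : Type*} (K F : Type*) [CommRing A] [IsDomain A] [CommRing B] [IsDomain B]
  [Field K] [Field F] [Algebra A K] [Algebra B F] [IsFractionRing A K] [IsFractionRing B F]
  (ε : A →+* B)

theorem comap_nonZeroDivisors_le : B⁰.comap ε ≤ A⁰ := fun b hb =>
  mem_nonZeroDivisors_of_ne_zero fun h => nonZeroDivisors.ne_zero (Submonoid.mem_comap.1 hb)
    (by rw [h, map_zero])

/-- The fractions whose denominator is not killed by `ε`. -/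
noncomputable def specRing : Subalgebra A K :=
  Localization.subalgebra.ofField K (B⁰.comap ε) (comap_nonZeroDivisors_le ε)

instance : IsLocalization (B⁰.comap ε) (specRing K ε) :=
  Localization.subalgebra.isLocalization_ofField K _ _

variable {K} in
theorem mem_specRing {x : K} :
    x ∈ specRing K ε ↔ ∃ a b : A, ε b ≠ 0 ∧ x = algebraMap A K a / algebraMap A K b := by
  constructor
  · rintro ⟨a, b, hb, rfl⟩
    exact ⟨a, b, nonZeroDivisors.ne_zero (Submonoid.mem_comap.1 hb), div_eq_mul_inv _ _ |>.symm⟩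
  · rintro ⟨a, b, hb, rfl⟩
    exact ⟨a, b, Submonoid.mem_comap.2 (mem_nonZeroDivisors_of_ne_zero hb), div_eq_mul_inv _ _⟩

/-- The map `a / b ↦ ε a / ε b`. -/
noncomputable def specHom : specRing K ε →+* F :=
  IsLocalization.lift (M := B⁰.comap ε) (g := (algebraMap B F).comp ε) fun y =>
    isUnit_iff_ne_zero.2 (IsFractionRing.to_map_ne_zero_of_mem_nonZeroDivisors y.2)

theorem specHom_div (x : specRing K ε) (a b : A) (hb : ε b ≠ 0)
    (hx : (x : K) = algebraMap A K a / algebraMap A K b) :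
    specHom K F ε x = algebraMap B F (ε a) / algebraMap B F (ε b) := by
  have hb' : algebraMap B F (ε b) ≠ 0 :=
    IsFractionRing.to_map_ne_zero_of_mem_nonZeroDivisors (mem_nonZeroDivisors_of_ne_zero hb)
  have hbK : algebraMap A K b ≠ 0 := IsFractionRing.to_map_ne_zero_of_mem_nonZeroDivisors
    (mem_nonZeroDivisors_of_ne_zero fun h => hb (by rw [h, map_zero]))
  have h : x * algebraMap A (specRing K ε) b = algebraMap A (specRing K ε) a := by
    apply Subtype.ext
    change (x : K) * algebraMap A K b = algebraMap A K a
    rw [hx, div_mul_cancel₀ _ hbK]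
  have := congrArg (specHom K F ε) h
  rw [map_mul] at this
  rw [eq_div_iff hb']
  simpa [specHom] using this

variable (δ : Der A) (δ' : Der B)

/-- The restriction to `specRing` of the extension of a derivation to the fraction field. -/
noncomputable def specDeriv : Der (specRing K ε) :=
  have hmem : ∀ x : specRing K ε, fracDeriv K δ (x : K) ∈ specRing K ε := by
    rintro ⟨x, hx⟩
    obtain ⟨a, b, hb, rfl⟩ := (mem_specRing ε).1 hx
    refine (mem_specRing ε).2 ⟨δ a * b - a * δ b, b ^ 2, by simpa using hb, ?_⟩
    rw [fracDeriv_div _ _ _ _ fun h => hb (by rw [h, map_zero])]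
    simp
  Derivation.mk' (AddMonoidHom.mk'
    (fun x : specRing K ε => (⟨fracDeriv K δ (x : K), hmem x⟩ : specRing K ε))
    fun x y => Subtype.ext (map_add (fracDeriv K δ) (x : K) y)).toIntLinearMap
    fun x y => Subtype.ext ((fracDeriv K δ).leibniz (x : K) y)

theorem coe_specDeriv (x : specRing K ε) :
    ((specDeriv K ε δ x : specRing K ε) : K) = fracDeriv K δ (x : K) := rfl

theorem specHom_specDeriv (hε : ∀ a, ε (δ a) = δ' (ε a)) (x : specRing K ε) :
    specHom K F ε (specDeriv K ε δ x) = fracDeriv F δ' (specHom K F ε x) := by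
  obtain ⟨a, b, hb, hx⟩ := (mem_specRing ε).1 x.2
  rw [specHom_div K F ε x a b hb hx, fracDeriv_div _ _ _ _ hb,
    specHom_div K F ε _ (δ a * b - a * δ b) (b ^ 2) (by simpa using hb)]
  · simp [hε]
  · rw [coe_specDeriv, hx, fracDeriv_div _ _ _ _ fun h => hb (by rw [h, map_zero])]
    simp

end Specialization

/-! ### Substitution and translation of the variables `x_1, …, x_n` -/

section Fields

variable (k : Type*) [Field k] (n : ℕ)

/-- The substitution `x = c` on polynomials in `t, x_1, …, x_n`. -/
noncomputable def polySpec (c : Fin n → k) : PolyTX k n →ₐ[k] k[X] :=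
  MvPolynomial.aeval fun o => o.elim Polynomial.X fun i => Polynomial.C (c i)

theorem polySpec_polyIncl (c : Fin n → k) (p : k[X]) : polySpec k n c (polyIncl k n p) = p := by
  have : (polySpec k n c).comp (polyIncl k n) = AlgHom.id k k[X] := by
    ext
    simp [polySpec, polyIncl]
  exact DFunLike.congr_fun this p

theorem polySpec_polyDerivTX (c : Fin n → k) (a : PolyTX k n) :
    polySpec k n c (polyDerivTX k n a) = polyDerivT k (polySpec k n c a) := by
  change polySpec k n c (MvPolynomial.pderiv none a) = Polynomial.derivative (polySpec k n c a)
  induction a using MvPolynomial.induction_on with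
  | C r => simp [polySpec]
  | add p q hp hq => simp [hp, hq]
  | mul_X p o hp =>
    have hX : polySpec k n c (MvPolynomial.pderiv none (MvPolynomial.X o))
        = Polynomial.derivative (polySpec k n c (MvPolynomial.X o)) := by
      cases o <;> simp [polySpec]
    rw [Derivation.leibniz, map_add, smul_eq_mul, smul_eq_mul, map_mul, map_mul, hp, hX, map_mul,
      Polynomial.derivative_mul]
    ring

theorem eval_polySpec (v : Option (Fin n) → k) (a : PolyTX k n) :
    (polySpec k n (fun i => v (some i)) a).eval (v none) = MvPolynomial.eval v a := by
  induction a using MvPolynomial.induction_on with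
  | C r => simp [polySpec]
  | add p q hp hq => simp [hp, hq]
  | mul_X p o hp =>
    rw [map_mul, Polynomial.eval_mul, hp]
    cases o <;> simp [polySpec]

/-- If every substitution gave zero, `a` would vanish at all points over an infinite field. -/
theorem exists_polySpec_ne_zero [Infinite k] {a : PolyTX k n} (ha : a ≠ 0) :
    ∃ c, polySpec k n c a ≠ 0 := by
  by_contra! h
  refine ha (MvPolynomial.funext fun v => ?_)
  rw [← eval_polySpec, h]
  simp

/-- The translation `x ↦ x + c` on polynomials. -/
noncomputable def polyTransHom (c : Fin n → k) : PolyTX k n →ₐ[k] PolyTX k n :=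
  MvPolynomial.aeval fun o =>
    o.elim (MvPolynomial.X none) fun i => MvPolynomial.X (some i) + MvPolynomial.C (c i)

theorem polyTransHom_comp_neg (c c' : Fin n → k) (h : c + c' = 0) :
    (polyTransHom k n c).comp (polyTransHom k n c') = AlgHom.id k _ := by
  ext o : 1
  cases o with
  | none => simp [polyTransHom]
  | some i =>
    have := congrFun h i
    simp only [Pi.add_apply, Pi.zero_apply] at this
    simp [polyTransHom, add_assoc, ← MvPolynomial.C_add, this]

/-- The translation `x ↦ x + c` as an automorphism of `k[t, x_1, …, x_n]`. -/
noncomputable def polyTrans (c : Fin n → k) : PolyTX k n ≃ₐ[k] PolyTX k n :=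
  AlgEquiv.ofAlgHom (polyTransHom k n c) (polyTransHom k n (-c))
    (polyTransHom_comp_neg k n _ _ (add_neg_cancel c))
    (polyTransHom_comp_neg k n _ _ (neg_add_cancel c))

/-- Makes invariance under translation a comparison of values at two different points. -/
theorem polySpec_polyTrans (c c' : Fin n → k) (a : PolyTX k n) :
    polySpec k n c (polyTrans k n c' a) = polySpec k n (c + c') a := by
  have : (polySpec k n c).comp (polyTransHom k n c') = polySpec k n (c + c') := by
    ext o : 1
    cases o <;> simp [polySpec, polyTransHom]
  exact DFunLike.congr_fun this a

theorem polyTrans_polyIncl (c : Fin n → k) (p : k[X]) :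
    polyTrans k n c (polyIncl k n p) = polyIncl k n p := by
  have : (polyTransHom k n c).comp (polyIncl k n) = polyIncl k n := by
    ext
    simp [polyTransHom, polyIncl]
  exact DFunLike.congr_fun this p

theorem polyTrans_polyDerivTX (c : Fin n → k) (a : PolyTX k n) :
    polyTrans k n c (polyDerivTX k n a) = polyDerivTX k n (polyTrans k n c a) := by
  change polyTransHom k n c (MvPolynomial.pderiv none a)
    = MvPolynomial.pderiv none (polyTransHom k n c a)
  induction a using MvPolynomial.induction_on with
  | C r => simp [polyTransHom]
  | add p q hp hq => simp [hp, hq]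
  | mul_X p o hp =>
    have hX : polyTransHom k n c (MvPolynomial.pderiv none (MvPolynomial.X o))
        = MvPolynomial.pderiv none (polyTransHom k n c (MvPolynomial.X o)) := by
      cases o <;> simp [polyTransHom]
    rw [Derivation.leibniz, map_add, smul_eq_mul, smul_eq_mul, map_mul, map_mul, hp, hX, map_mul,
      Derivation.leibniz, smul_eq_mul, smul_eq_mul]

/-- The translation `x ↦ x + c` as an automorphism of `k(t, x_1, …, x_n)`. -/
noncomputable def fieldTrans (c : Fin n → k) : FieldTX k n ≃+* FieldTX k n :=
  IsFractionRing.ringEquivOfRingEquiv (polyTrans k n c).toRingEquiv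

theorem fieldTrans_algebraMap (c : Fin n → k) (a : PolyTX k n) :
    fieldTrans k n c (algebraMap _ _ a) = algebraMap _ _ (polyTrans k n c a) :=
  IsFractionRing.ringEquivOfRingEquiv_algebraMap _ _

theorem fieldTrans_derivTX (c : Fin n → k) (f : FieldTX k n) :
    fieldTrans k n c (derivTX k n f) = derivTX k n (fieldTrans k n c f) := by
  obtain ⟨a, b, hb, rfl⟩ := exists_frac (A := PolyTX k n) f
  have hb' : polyTrans k n c b ≠ 0 := by simpa using hb
  unfold derivTX
  rw [fracDeriv_div _ _ _ _ hb]
  simp only [map_div₀, map_sub, map_mul, map_pow, fieldTrans_algebraMap]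
  rw [fracDeriv_div _ _ _ _ hb', polyTrans_polyDerivTX, polyTrans_polyDerivTX]

theorem fieldTrans_fieldIncl (c : Fin n → k) (f : RatFunc k) :
    fieldTrans k n c (fieldIncl k n f) = fieldIncl k n f := by
  obtain ⟨a, b, hb, rfl⟩ := exists_frac (A := k[X]) f
  simp only [map_div₀, fieldIncl_algebraMap, fieldTrans_algebraMap, polyTrans_polyIncl]

/-- The elements fixed by all translations are those of `k(t)`. -/
theorem mem_range_fieldIncl_of_fixed [Infinite k] {f : FieldTX k n}
    (hf : ∀ c, fieldTrans k n c f = f) : f ∈ (fieldIncl k n).range := by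
  obtain ⟨a, b, hb, rfl⟩ := exists_frac (A := PolyTX k n) f
  have hinj := IsFractionRing.injective (PolyTX k n) (FieldTX k n)
  have hne : ∀ {b : PolyTX k n}, b ≠ 0 → algebraMap (PolyTX k n) (FieldTX k n) b ≠ 0 :=
    fun hb h => hb (hinj (by rw [h, map_zero]))
  -- At a point `c₀` where the denominator survives, `f(t, c₀)` is the candidate in `k(t)`.
  obtain ⟨c₀, hc₀⟩ := exists_polySpec_ne_zero k n hb
  -- This is `f(t, c) = f(t, c₀)` with denominators cleared: translate by `c - c₀`, then substitute
  -- `c₀`.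
  have h1 : ∀ c, polySpec k n c a * polySpec k n c₀ b = polySpec k n c₀ a * polySpec k n c b := by
    intro c
    have h := hf (c - c₀)
    rw [map_div₀, fieldTrans_algebraMap, fieldTrans_algebraMap,
      div_eq_div_iff (hne (by simpa using hb)) (hne hb), ← map_mul, ← map_mul] at h
    have := congrArg (polySpec k n c₀) (hinj h)
    rwa [map_mul, map_mul, polySpec_polyTrans, polySpec_polyTrans, add_sub_cancel] at this
  have h2 : polyIncl k n (polySpec k n c₀ a) * b = a * polyIncl k n (polySpec k n c₀ b) := by
    refine MvPolynomial.funext fun v => ?_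
    have h := congrArg (Polynomial.eval (v none)) (h1 fun i => v (some i))
    simp only [Polynomial.eval_mul, eval_polySpec] at h
    have h3 : ∀ p, MvPolynomial.eval v (polyIncl k n p) = p.eval (v none) := fun p => by
      rw [← eval_polySpec, polySpec_polyIncl]
    rw [map_mul, map_mul, h3, h3, ← h]
  have hb₀ : polyIncl k n (polySpec k n c₀ b) ≠ 0 := fun h =>
    hc₀ (polyIncl_injective k n (by rw [h, map_zero]))
  refine ⟨algebraMap _ _ (polySpec k n c₀ a) / algebraMap _ _ (polySpec k n c₀ b), ?_⟩
  rw [map_div₀, fieldIncl_algebraMap, fieldIncl_algebraMap, div_eq_div_iff (hne hb₀) (hne hb),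
    ← map_mul, ← map_mul, h2]

/-- Finitely many operators over `k(t, x_1, …, x_n)` can be specialized simultaneously to
operators over `k(t)`. -/
theorem exists_specialization [Infinite k] (T : Finset (DiffOp (derivTX k n))) :
    ∃ (R : Subring (FieldTX k n)) (e : Der R)
      (hj : ∀ a, R.subtype (e a) = derivTX k n (R.subtype a))
      (s : R →+* RatFunc k) (hs : ∀ a, s (e a) = derivT k (s a)),
      (∀ Q, ∃ Q', DiffOp.map R.subtype hj Q' = opIncl k n Q ∧ DiffOp.map s hs Q' = Q) ∧
      ∀ P ∈ T, ∃ P', DiffOp.map R.subtype hj P' = P := by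
  classical
  let U : Finset (FieldTX k n) := T.biUnion fun P => P.toPoly.coeffs
  -- `D` is a common denominator of all coefficients; any `c` with `D(t, c) ≠ 0` serves.
  obtain ⟨⟨D, hD⟩, hDU⟩ := IsLocalization.exist_integer_multiples_of_finset (PolyTX k n)⁰ U
  have hD0 := nonZeroDivisors.ne_zero hD
  obtain ⟨c, hc⟩ := exists_polySpec_ne_zero k n hD0
  let ε : PolyTX k n →+* k[X] := (polySpec k n c : PolyTX k n →+* k[X])
  have hincl : ∀ f, fieldIncl k n f ∈ specRing (FieldTX k n) ε ∧ ∀ h,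
      specHom (FieldTX k n) (RatFunc k) ε ⟨fieldIncl k n f, h⟩ = f := by
    intro f
    obtain ⟨p, q, hq, rfl⟩ := exists_frac (A := k[X]) f
    have h1 : ε (polyIncl k n q) ≠ 0 := by
      change polySpec k n c (polyIncl k n q) ≠ 0
      rwa [polySpec_polyIncl]
    have h2 : fieldIncl k n (algebraMap _ _ p / algebraMap _ _ q)
        = algebraMap _ _ (polyIncl k n p) / algebraMap _ _ (polyIncl k n q) := by
      rw [map_div₀, fieldIncl_algebraMap, fieldIncl_algebraMap]
    refine ⟨(mem_specRing ε).2 ⟨_, _, h1, h2⟩, fun h => ?_⟩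
    rw [specHom_div _ _ ε _ _ _ h1 h2]
    change algebraMap _ _ (polySpec k n c (polyIncl k n p))
      / algebraMap _ _ (polySpec k n c (polyIncl k n q)) = _
    rw [polySpec_polyIncl, polySpec_polyIncl]
  let R : Subring (FieldTX k n) := (specRing (FieldTX k n) ε).toSubring
  let e : Der R := specDeriv (FieldTX k n) ε (polyDerivTX k n)
  have hj : ∀ a, R.subtype (e a) = derivTX k n (R.subtype a) := fun _ => rfl
  let s : R →+* RatFunc k := specHom (FieldTX k n) (RatFunc k) ε
  have hs : ∀ a, s (e a) = derivT k (s a) :=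
    specHom_specDeriv _ _ ε (polyDerivTX k n) (polyDerivT k) (polySpec_polyDerivTX k n c)
  have hU : ∀ f ∈ U, f ∈ R := by
    intro f hf
    obtain ⟨a, ha⟩ := hDU f hf
    refine (mem_specRing ε).2 ⟨a, D, hc, ?_⟩
    rw [ha, Algebra.smul_def, mul_div_cancel_left₀]
    exact IsFractionRing.to_map_ne_zero_of_mem_nonZeroDivisors hD
  refine ⟨R, e, hj, s, hs, fun Q => ?_, fun P hP => ?_⟩
  · let i : RatFunc k →+* R := (fieldIncl k n).codRestrict R fun f => (hincl f).1
    have hi : ∀ a, i (derivT k a) = e (i a) := fun a =>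
      Subtype.ext (fieldIncl_derivT k n a)
    refine ⟨DiffOp.map i hi Q, DiffOp.ext ?_, DiffOp.ext ?_⟩
    · change (Q.toPoly.map i).map R.subtype = Q.toPoly.map (fieldIncl k n)
      rw [Polynomial.map_map]
      rfl
    · change (Q.toPoly.map i).map s = Q.toPoly
      rw [Polynomial.map_map]
      have : s.comp i = RingHom.id _ := RingHom.ext fun f => (hincl f).2 _
      rw [this, Polynomial.map_id]
  · refine DiffOp.mem_range_map _ hj P fun i => ?_
    by_cases h0 : P.toPoly.coeff i = 0
    · rw [h0]
      exact zero_mem _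
    · exact ⟨⟨_, hU _ (Finset.mem_biUnion.2 ⟨P, hP, Polynomial.coeff_mem_coeffs h0⟩)⟩, rfl⟩

end Fields

/-! ### Comparison of factorizations over `k(t)` and `K` -/

section Comparison

open DiffOp

variable {k : Type*} [Field k] (n : ℕ)

theorem opIncl_injective : Function.Injective (opIncl k n) :=
  map_injective _ _ (fieldIncl k n).injective

theorem ord_opIncl (P : DiffOp (derivT k)) : (opIncl k n P).ord = P.ord :=
  ord_map _ _ (fieldIncl k n).injective P

theorem isMonic_opIncl_iff {P : DiffOp (derivT k)} : (opIncl k n P).IsMonic ↔ P.IsMonic :=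
  isMonic_map_iff _ _ (fieldIncl k n).injective

/-- A factorization over `K` specializes to one over `k(t)` with factors of the same orders. -/
theorem irreducible_opIncl [Infinite k] {P : DiffOp (derivT k)} (hP : Irreducible P) :
    Irreducible (opIncl k n P) := by
  have hP0 : opIncl k n P ≠ 0 := by
    rw [← map_zero (opIncl k n)]
    exact (opIncl_injective n).ne hP.ne_zero
  refine ⟨fun h => hP.not_isUnit ?_, fun A B hAB => ?_⟩
  · rw [isUnit_iff, ord_opIncl] at h
    exact isUnit_iff.2 ⟨hP.ne_zero, h.2⟩
  have hA0 : A ≠ 0 := left_ne_zero_of_mul (hAB ▸ hP0)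
  have hB0 : B ≠ 0 := right_ne_zero_of_mul (hAB ▸ hP0)
  -- Substitution may kill a leading coefficient. With the right factor made monic its order is
  -- preserved, and the order of the left factor follows by additivity.
  obtain ⟨B₁, hB₁, hB⟩ := exists_const_mul_isMonic hB0
  have hu : IsUnit (const (derivTX k n) B.toPoly.leadingCoeff) :=
    isUnit_const (Polynomial.leadingCoeff_ne_zero.2 (mt toPoly_eq_zero.1 hB0))
  have hoB : B.ord = B₁.ord := by
    have h := congrArg ord hB
    rwa [ord_mul hu.ne_zero hB₁.ne_zero, (isUnit_iff.1 hu).2, zero_add] at h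
  rw [hB, ← mul_assoc] at hAB
  classical
  obtain ⟨R, e, hj, s, hs, hspec, hT⟩ := exists_specialization k n
    {A * const (derivTX k n) B.toPoly.leadingCoeff, B₁}
  obtain ⟨A', hA'⟩ := hT (A * const (derivTX k n) B.toPoly.leadingCoeff) (by simp)
  obtain ⟨B', hB'⟩ := hT B₁ (by simp)
  obtain ⟨P', hP', hPs⟩ := hspec P
  have hjinj := map_injective R.subtype hj R.subtype_injective
  have hP'eq : P' = A' * B' := hjinj (by rw [map_mul, hP', hA', hB', hAB])
  have hBm : B'.IsMonic := (isMonic_map_iff R.subtype hj R.subtype_injective).1 (hB' ▸ hB₁)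
  have hoB' : (DiffOp.map s hs B').ord = B₁.ord := by
    rw [← hB', ord_map _ _ R.subtype_injective]
    exact Polynomial.Monic.natDegree_map hBm s
  have hPeq : P = DiffOp.map s hs A' * DiffOp.map s hs B' := by rw [← hPs, hP'eq, map_mul]
  rcases hP.isUnit_or_isUnit hPeq with h | h
  · refine Or.inl (isUnit_iff.2 ⟨hA0, ?_⟩)
    rw [isUnit_iff] at h
    have h1 : P.ord = B₁.ord := by
      rw [hPeq, ord_mul h.1 (hBm.map s hs).ne_zero, h.2, hoB', zero_add]
    have h2 := ord_opIncl n P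
    rw [hAB, ord_mul (mul_ne_zero hA0 hu.ne_zero) hB₁.ne_zero, ord_mul hA0 hu.ne_zero] at h2
    omega
  · refine Or.inr (isUnit_iff.2 ⟨hB0, ?_⟩)
    rw [isUnit_iff, hoB'] at h
    exact hoB.trans h.2

/-- For the descent, specialize the cofactor; `P` and `Q` are unchanged. -/
theorem opIncl_mem_span_iff [Infinite k] {P Q : DiffOp (derivT k)} :
    opIncl k n P ∈ Ideal.span {opIncl k n Q} ↔ P ∈ Ideal.span {Q} := by
  simp only [Ideal.mem_span_singleton']
  constructor
  · rintro ⟨A, hA⟩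
    obtain ⟨R, e, hj, s, hs, hspec, hT⟩ := exists_specialization k n {A}
    obtain ⟨A', hA'⟩ := hT A (by simp)
    obtain ⟨P', hP', hPs⟩ := hspec P
    obtain ⟨Q', hQ', hQs⟩ := hspec Q
    have h : A' * Q' = P' := map_injective R.subtype hj R.subtype_injective (by
      rw [map_mul, hA', hQ', hP', hA])
    exact ⟨DiffOp.map s hs A', by rw [← hQs, ← hPs, ← map_mul, h]⟩
  · rintro ⟨A, rfl⟩
    exact ⟨opIncl k n A, (map_mul _ _ _).symm⟩

/-- The translation `x ↦ x + c` on operators. -/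
noncomputable def opTrans (c : Fin n → k) : DiffOp (derivTX k n) ≃+* DiffOp (derivTX k n) :=
  RingEquiv.ofBijective (DiffOp.map (fieldTrans k n c : FieldTX k n →+* FieldTX k n)
    (fieldTrans_derivTX k n c))
    ⟨map_injective _ _ (fieldTrans k n c).injective, fun P =>
      mem_range_map _ _ P fun _ => (fieldTrans k n c).surjective _⟩

theorem opTrans_opIncl (c : Fin n → k) (P : DiffOp (derivT k)) :
    opTrans n c (opIncl k n P) = opIncl k n P := by
  refine DiffOp.ext (Polynomial.ext fun i => ?_)
  change ((P.toPoly.map (fieldIncl k n)).map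
    (fieldTrans k n c : FieldTX k n →+* FieldTX k n)).coeff i = (P.toPoly.map (fieldIncl k n)).coeff i
  simp [fieldTrans_fieldIncl]

/-- The maximal completely reducible right-hand factor over `k(t, x_1, …, x_n)` of an operator
over `k(t)` is defined over `k(t)`. -/
theorem exists_opIncl_eq_of_isMaxCRRightFactor [Infinite k] {P : DiffOp (derivT k)} (hP : P ≠ 0)
    {G : DiffOp (derivTX k n)} (hG : IsMaxCRRightFactor G (opIncl k n P)) :
    ∃ H, opIncl k n H = G := by
  have hP0 : opIncl k n P ≠ 0 := by
    rw [← map_zero (opIncl k n)]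
    exact (opIncl_injective n).ne hP
  -- Translations are automorphisms fixing `P`, so uniqueness makes them fix `G`.
  have hfix : ∀ c, opTrans n c G = G := by
    intro c
    have h := hG.mapEquiv (opTrans n c)
      (fun Q hQ => hQ.map (fieldTrans k n c : FieldTX k n →+* FieldTX k n)
        (fieldTrans_derivTX k n c))
      (fun Q => ord_map (fieldTrans k n c : FieldTX k n →+* FieldTX k n)
        (fieldTrans_derivTX k n c) (fieldTrans k n c).injective Q)
    rw [opTrans_opIncl] at h
    exact h.unique hP0 hG
  refine mem_range_map _ _ G fun i => mem_range_fieldIncl_of_fixed k n fun c => ?_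
  have h := congrArg (fun Q : DiffOp (derivTX k n) => Q.toPoly.coeff i) (hfix c)
  change (G.toPoly.map (fieldTrans k n c : FieldTX k n →+* FieldTX k n)).coeff i = _ at h
  rwa [Polynomial.coeff_map] at h

/-- Complete reducibility descends from `k(t, x_1, …, x_n)` to `k(t)`. -/
theorem jacobson_span_eq_of_opIncl [Infinite k] {G : DiffOp (derivT k)} (hG : G ≠ 0)
    (hJ : (Ideal.span {opIncl k n G}).jacobson = Ideal.span {opIncl k n G}) :
    (Ideal.span {G}).jacobson = Ideal.span {G} := by
  have hG0 : opIncl k n G ≠ 0 := by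
    rw [← map_zero (opIncl k n)]
    exact (opIncl_injective n).ne hG
  obtain ⟨Q, hQ⟩ := (IsPrincipalIdealRing.principal (Ideal.span {G}).jacobson).principal
  change _ = Ideal.span {Q} at hQ
  -- The complement exists a priori only over `K`. It is encoded by `A C = G`, `U Q + V C = 1`, `A₁
  -- G = C U Q` and `A₂ G = Q V C`, which survive specialization.
  obtain ⟨C, hGC, htop, hinf⟩ := exists_complement hG0 hJ (Ideal.span {opIncl k n Q})
  set ι := opIncl k n with hι
  obtain ⟨A, hA⟩ := Ideal.mem_span_singleton'.1 hGC
  obtain ⟨x, hx, y, hy, hxy⟩ := Submodule.mem_sup.1 ((Ideal.eq_top_iff_one _).1 htop)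
  obtain ⟨U, rfl⟩ := Ideal.mem_span_singleton'.1 hx
  obtain ⟨V, rfl⟩ := Ideal.mem_span_singleton'.1 hy
  -- The left ideals generated by `Q` and `C` meet in the one generated by `C U Q` and `Q V C`.
  have h1 : C * (U * ι Q) ∈ Ideal.span {ι G} := by
    refine hinf ⟨Ideal.mul_mem_left _ _ hx, ?_⟩
    have : C * (U * ι Q) = (1 - C * V) * C := by
      rw [eq_sub_of_add_eq hxy]
      noncomm_ring
    exact this ▸ Ideal.mul_mem_left _ _ (Ideal.mem_span_singleton_self C)
  have h2 : ι Q * (V * C) ∈ Ideal.span {ι G} := by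
    refine hinf ⟨?_, Ideal.mul_mem_left _ _ hy⟩
    have : ι Q * (V * C) = (1 - ι Q * U) * ι Q := by
      rw [eq_sub_of_add_eq' hxy]
      noncomm_ring
    exact this ▸ Ideal.mul_mem_left _ _ (Ideal.mem_span_singleton_self _)
  obtain ⟨A₁, hA₁⟩ := Ideal.mem_span_singleton'.1 h1
  obtain ⟨A₂, hA₂⟩ := Ideal.mem_span_singleton'.1 h2
  classical
  obtain ⟨R, e, hj, s, hs, hspec, hT⟩ := exists_specialization k n {A, A₁, A₂, C, U, V}
  obtain ⟨A', hA'⟩ := hT A (by simp)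
  obtain ⟨A₁', hA₁'⟩ := hT A₁ (by simp)
  obtain ⟨A₂', hA₂'⟩ := hT A₂ (by simp)
  obtain ⟨C', hC'⟩ := hT C (by simp)
  obtain ⟨U', hU'⟩ := hT U (by simp)
  obtain ⟨V', hV'⟩ := hT V (by simp)
  obtain ⟨G', hG', hGs⟩ := hspec G
  obtain ⟨Q', hQ', hQs⟩ := hspec Q
  have hjinj := map_injective R.subtype hj R.subtype_injective
  set σ := DiffOp.map s hs
  have e0 : σ A' * σ C' = G := by
    rw [← map_mul, ← hGs, hjinj (a₁ := A' * C') (a₂ := G')]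
    rw [map_mul, hA', hC', hG', hA]
  have e1 : σ U' * Q + σ V' * σ C' = 1 := by
    rw [← hQs, ← map_mul, ← map_mul, ← map_add, ← map_one σ,
      hjinj (a₁ := U' * Q' + V' * C') (a₂ := 1)]
    rw [map_add, map_mul, map_mul, hU', hV', hC', hQ', hxy, map_one]
  have e2 : σ A₁' * G = σ C' * (σ U' * Q) := by
    rw [← hQs, ← hGs, ← map_mul, ← map_mul, ← map_mul,
      hjinj (a₁ := A₁' * G') (a₂ := C' * (U' * Q'))]
    rw [map_mul, map_mul, map_mul, hA₁', hU', hC', hQ', hG', hA₁]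
  have e3 : σ A₂' * G = Q * (σ V' * σ C') := by
    rw [← hQs, ← hGs, ← map_mul, ← map_mul, ← map_mul,
      hjinj (a₁ := A₂' * G') (a₂ := Q' * (V' * C'))]
    rw [map_mul, map_mul, map_mul, hA₂', hV', hC', hQ', hG', hA₂]
  refine jacobson_eq_of_complement (C := Ideal.span {σ C'}) ?_ ?_ ?_
  · exact (Ideal.span_singleton_le_iff_mem _).2 (Ideal.mem_span_singleton'.2 ⟨_, e0⟩)
  · rw [hQ, Ideal.eq_top_iff_one, ← e1]
    exact add_mem
      (Submodule.mem_sup_left (Ideal.mul_mem_left _ _ (Ideal.mem_span_singleton_self _)))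
      (Submodule.mem_sup_right (Ideal.mul_mem_left _ _ (Ideal.mem_span_singleton_self _)))
  · rw [hQ]
    rintro X ⟨hXQ, hXC⟩
    obtain ⟨a, ha⟩ := Ideal.mem_span_singleton'.1 hXQ
    obtain ⟨b, hb⟩ := Ideal.mem_span_singleton'.1 hXC
    -- Expand `X = X (U Q + V C)`, writing `X` as a multiple of `C` in the first term and of `Q` in
    -- the second.
    have : X = (b * σ A₁' + a * σ A₂') * G := by
      rw [add_mul, mul_assoc, mul_assoc, e2, e3, ← mul_assoc b, ← mul_assoc a, ha, hb, ← mul_add,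
        e1, mul_one]
    exact Ideal.mem_span_singleton'.2 ⟨_, this.symm⟩

/-- The factor over `K` comes from some `G` over `k(t)`. Ascent of irreducibility makes `G` a left
multiple of `H`; descent of complete reducibility, with monotonicity of the radical, makes `H` a
left multiple of `G`. -/
theorem isMaxCRRightFactor_opIncl [Infinite k] {H P : DiffOp (derivT k)} (hP : P ≠ 0)
    (h : IsMaxCRRightFactor H P) : IsMaxCRRightFactor (opIncl k n H) (opIncl k n P) := by
  have hP0 : opIncl k n P ≠ 0 := by
    rw [← map_zero (opIncl k n)]
    exact (opIncl_injective n).ne hP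
  obtain ⟨G, hG⟩ := exists_isMaxCRRightFactor hP0
  obtain ⟨G, rfl⟩ := exists_opIncl_eq_of_isMaxCRRightFactor n hP hG
  suffices hGH : G = H from hGH ▸ hG
  have hG' := (isMaxCRRightFactor_iff hP0).1 hG
  have hH' := (isMaxCRRightFactor_iff hP).1 h
  have hGm := (isMonic_opIncl_iff n).1 hG'.1
  refine hGm.eq_of_span_eq hH'.1 (le_antisymm ?_ ?_)
  · rw [hH'.2, Ideal.span_singleton_le_iff_mem, mem_jacobson_span_iff hP]
    rintro M ⟨hM, A, rfl⟩
    rw [isRightFactor_iff, ← opIncl_mem_span_iff n, ← isRightFactor_iff]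
    exact IsLCLM.isRightFactor hG _ ⟨irreducible_opIncl n hM, opIncl k n A, map_mul _ _ _⟩
  · rw [hH'.2, ← jacobson_span_eq_of_opIncl n hGm.ne_zero (by rw [hG'.2, Ideal.jacobson_idem])]
    refine Ideal.jacobson_mono ((Ideal.span_singleton_le_iff_mem _).2 ?_)
    rw [← opIncl_mem_span_iff n, hG'.2]
    exact Ideal.le_jacobson (Ideal.mem_span_singleton_self _)

/-- Induction on the order: the cofactor of the maximal completely reducible right-hand factor is
monic of smaller order, and each peeled factor serves over both fields. -/
theorem exists_isMCRDecomposition [Infinite k] {P : DiffOp (derivT k)} (hP : P.IsMonic) :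
    ∃ Hs : List (DiffOp (derivT k)), P.IsMCRDecomposition 1 Hs ∧
      (opIncl k n P).IsMCRDecomposition 1 (Hs.map (opIncl k n)) := by
  induction hm : P.ord using Nat.strong_induction_on generalizing P with
  | _ m ih =>
    rcases Nat.eq_zero_or_pos P.ord with h0 | h0
    · obtain rfl := hP.eq_one h0
      exact ⟨[], isMCRDecomposition_nil.2 rfl, isMCRDecomposition_nil.2 (map_one _)⟩
    · obtain ⟨H, hH⟩ := exists_isMaxCRRightFactor hP.ne_zero
      obtain ⟨A, hA⟩ := hH.isRightFactor hP.ne_zero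
      have hpos := hH.ord_pos hP.ne_zero h0
      have hAm : A.IsMonic := IsMonic.of_mul (hA ▸ hP) hH.monic
      have hlt : A.ord < m := by
        rw [← hm, hA, ord_mul hAm.ne_zero hH.monic.ne_zero]
        omega
      obtain ⟨Hs, h1, h2⟩ := ih _ hlt hAm rfl
      refine ⟨H :: Hs, isMCRDecomposition_cons.2 ⟨hpos, hH, A, hA, h1⟩, ?_⟩
      rw [List.map_cons]
      exact isMCRDecomposition_cons.2 ⟨by rwa [ord_opIncl],
        isMaxCRRightFactor_opIncl n hP.ne_zero hH,
        opIncl k n A, by rw [hA, map_mul], h2⟩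

end Comparison

/-! ### The main theorem -/

theorem mainTheorem6 {k : Type*} [Field k] [IsAlgClosed k] [CharZero k] (n : ℕ) :
    (∀ L : DiffOp (derivT k), L ≠ 0 →
      ∃ (lam : RatFunc k) (Hs : List (DiffOp (derivT k))),
        (∀ (lam' : RatFunc k) (Hs' : List (DiffOp (derivT k))),
          L.IsMCRDecomposition lam' Hs' ↔ lam' = lam ∧ Hs' = Hs) ∧
        (∀ (mu : FieldTX k n) (Gs : List (DiffOp (derivTX k n))),
          (opIncl k n L).IsMCRDecomposition mu Gs ↔
            mu = fieldIncl k n lam ∧ Gs = Hs.map (opIncl k n))) ∧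
    (∀ P : DiffOp (derivT k), Irreducible P → Irreducible (opIncl k n P)) := by
  refine ⟨fun L hL => ?_, fun P hP => irreducible_opIncl n hP⟩
  obtain ⟨P, hP, hLP⟩ := DiffOp.exists_const_mul_isMonic hL
  have hlam : L.toPoly.leadingCoeff ≠ 0 :=
    Polynomial.leadingCoeff_ne_zero.2 (mt DiffOp.toPoly_eq_zero.1 hL)
  generalize L.toPoly.leadingCoeff = lam at hLP hlam
  subst hLP
  obtain ⟨Hs, h1, h2⟩ := exists_isMCRDecomposition n hP
  have hPK := (isMonic_opIncl_iff n).2 hP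
  refine ⟨lam, Hs, fun lam' Hs' => ?_, fun mu Gs => ?_⟩
  · rw [DiffOp.isMCRDecomposition_const_mul hP hlam]
    exact and_congr_right fun _ => ⟨h1.unique hP, fun h => h ▸ h1⟩
  · have hc : opIncl k n (DiffOp.const (derivT k) lam)
        = DiffOp.const (derivTX k n) (fieldIncl k n lam) := DiffOp.map_const _ _ lam
    rw [map_mul, hc, DiffOp.isMCRDecomposition_const_mul hPK
      ((map_ne_zero (fieldIncl k n)).2 hlam)]
    exact and_congr_right fun _ => ⟨h2.unique hPK, fun h => h ▸ h2⟩
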